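/- **Proposition.** Let $\mathbf k$ be a commutative unital ring and let $A$ be an $A_\infty$-category over $\mathbf k$, that is, a collection of objects, $\mathbb Z$-graded $\mathbf k$-modules $\hom_A(X,Y)$, and $\mathbf k$-multilinear operations $m^n$ ($n\ge 1$) of degree $2-n$ on composable morphisms satisfying $\sum_{\alpha+\beta+\gamma=l}(-1)^{\alpha+\beta\gamma}\,m^{\alpha+1+\gamma}(\mathrm{id}^{\otimes\alpha}\otimes m^\beta\otimes \mathrm{id}^{\otimes\gamma})=0$ for all $l\ge 1$ (with the Koszul sign rule). Assume that $A$ is unital: every object $X$ has a unit, i.e. a closed degree-zero element $e\in\hom_A(X,X)$ such that for every object $W$ the chain maps $m^2(e,-)$ on $\hom_A(W,X)$ and $m^2(-,e)$ on $\hom_A(X,W)$ are homotopic to the identity. Let $X,Y$ be objects of $A$ and let $f,g\in\hom_A(X,Y)$ be closed morphisms of degree $0$ that are cohomologous, i.e. $f-g=m^1(h)$ for some $h\in\hom_A(X,Y)$ of degree $-1$. Let $\mathrm{Tw}\,A$ be the $A_\infty$-category of twisted complexes over $A$ (finite formal sums $\bigoplus_i s^{n_i}X_i$ of shifted objects of $A$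 with a strictly triangular degree-one endomorphism $\delta$ satisfying the Maurer--Cartan equation), and let $\mathrm{cone}(f)$ be the twisted complex $sX\oplus Y$ with $\delta$ given by $f$, and similarly for $g$. Then $\mathrm{cone}(f)$ and $\mathrm{cone}(g)$ are isomorphic in $H^0(\mathrm{Tw}\,A)$: there are closed degree-zero morphisms $a:\mathrm{cone}(f)\to\mathrm{cone}(g)$ and $b:\mathrm{cone}(g)\to\mathrm{cone}(f)$ in $\mathrm{Tw}\,A$ such that $m^2(b,a)$ and $m^2(a,b)$ are cohomologous to units of $\mathrm{cone}(f)$ and $\mathrm{cone}(g)$, respectively. -/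

import Mathlib

open scoped DirectSum

universe u v w

/-- `ℤ`-graded `k`-modules of morphisms between the elements of `Ob`. -/
structure GradedQuiver (k : Type w) [CommRing k] (Ob : Type u) where
  Hom : Ob → Ob → ℤ → Type v
  [addCommGroup : ∀ X Y d, AddCommGroup (Hom X Y d)]
  [module : ∀ X Y d, Module k (Hom X Y d)]

attribute [instance] GradedQuiver.addCommGroup GradedQuiver.module

namespace GradedQuiver

variable {k : Type w} [CommRing k] {Ob : Type u}

/-- The total graded module `⨁ d, Hom X Y d`. -/
abbrev Tot (Q : GradedQuiver.{u, v} k Ob) (X Y : Ob) : Type v := ⨁ d, Q.Hom X Y d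

/-- `Q.Chain X Y` is the type of composable sequences `X = X₀ → X₁ → ⋯ → Xₙ = Y` of homogeneous
morphisms `x₁, …, xₙ`; `cons` adds a morphism at the source end. -/
inductive Chain (Q : GradedQuiver.{u, v} k Ob) : Ob → Ob → Type (max u v)
  | nil (X : Ob) : Chain Q X X
  | cons {X Y Z : Ob} {d : ℤ} (x : Q.Hom X Y d) (p : Chain Q Y Z) : Chain Q X Z

namespace Chain

variable {Q : GradedQuiver.{u, v} k Ob}

/-- The number of morphisms. -/
def length : {X Y : Ob} → Q.Chain X Y → ℤ
  | _, _, nil _ => 0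
  | _, _, cons _ p => p.length + 1

/-- The sum of the degrees. -/
def deg : {X Y : Ob} → Q.Chain X Y → ℤ
  | _, _, nil _ => 0
  | _, _, cons (d := d) _ p => d + p.deg

/-- `∑ⱼ (j - 1) |xⱼ|`: the exponent of the Koszul sign of applying `s ⊗ ⋯ ⊗ s` (`s` of degree
`-1`) to `xₙ ⊗ ⋯ ⊗ x₁`. -/
def shiftSign : {X Y : Ob} → Q.Chain X Y → ℤ
  | _, _, nil _ => 0
  | _, _, cons _ p => p.shiftSign + p.deg

/-- Concatenation: first `p`, then `q`. -/
def comp : {X Y Z : Ob} → Q.Chain X Y → Q.Chain Y Z → Q.Chain X Z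
  | _, _, _, nil _, q => q
  | _, _, _, cons x p, q => cons x (p.comp q)

/-- The list of all ways to write a chain as a concatenation of two chains. -/
def splits : {X Y : Ob} → Q.Chain X Y → List (Σ Z, Q.Chain X Z × Q.Chain Z Y)
  | _, _, nil X => [⟨X, nil X, nil X⟩]
  | _, _, cons x p =>
      ⟨_, nil _, cons x p⟩ :: p.splits.map fun s => ⟨s.1, cons x s.2.1, s.2.2⟩

end Chain

end GradedQuiver

open GradedQuiver (Chain)

/-- A graded quiver with `k`-multilinear operations `mⁿ` (`n ≥ 1`) of degree `2 - n`. For the chain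
`p = (x₁, …, xₙ)`, the element `m p` is `mⁿ(xₙ, …, x₁)`. There is no `m⁰`: `m_nil` fixes the value
on the empty chain to be `0`. The degree `e` of the value is a separate argument. -/
structure AInftyData (k : Type w) [CommRing k] (Ob : Type u) extends
    GradedQuiver.{u, v} k Ob where
  m : ∀ {X Y : Ob} (p : toGradedQuiver.Chain X Y) (e : ℤ), p.deg + 2 - p.length = e → Hom X Y e
  m_nil : ∀ (X : Ob) (e : ℤ) (h), m (Chain.nil X) e h = 0
  m_add : ∀ {W X Y Z : Ob} (p : toGradedQuiver.Chain W X) {d : ℤ} (x y : Hom X Y d)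
    (q : toGradedQuiver.Chain Y Z) (e : ℤ) (h₁ h₂ h₃),
    m (p.comp (.cons (x + y) q)) e h₁ = m (p.comp (.cons x q)) e h₂ + m (p.comp (.cons y q)) e h₃
  m_smul : ∀ {W X Y Z : Ob} (p : toGradedQuiver.Chain W X) {d : ℤ} (c : k) (x : Hom X Y d)
    (q : toGradedQuiver.Chain Y Z) (e : ℤ) (h₁ h₂),
    m (p.comp (.cons (c • x) q)) e h₁ = c • m (p.comp (.cons x q)) e h₂

namespace AInftyData

variable {k : Type w} [CommRing k] {Ob : Type u} (A : AInftyData.{u, v} k Ob)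

/-- `mⁿ(xₙ, …, x₁)` as an element of the total module. -/
def mTot {X Y : Ob} (p : A.Chain X Y) : A.Tot X Y :=
  DirectSum.of (A.Hom X Y) (p.deg + 2 - p.length) (A.m p _ rfl)

/-- The left hand side of the `A_∞`-relation on `xₗ ⊗ ⋯ ⊗ x₁`, where `p = (x₁, …, xₗ)`:
the sum of `(-1)^(α + βγ) m (id^α ⊗ m^β ⊗ id^γ)`. Here `p` is the concatenation of `p₁`, `p₂`, `p₃`
of lengths `γ`, `β`, `α`; since `m^β` has degree `2 - β`, moving it past the entries of `p₃` gives
the Koszul sign `(-1)^(β * |p₃|)`. (The terms with `β = 0` vanish.) -/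
def relationSum {X Y : Ob} (p : A.Chain X Y) : A.Tot X Y :=
  (p.splits.map fun s => (s.2.2.splits.map fun t =>
    let p₁ := s.2.1
    let p₂ := t.2.1
    let p₃ := t.2.2
    (p₃.length + p₂.length * p₁.length + p₂.length * p₃.deg).negOnePow •
      A.mTot (p₁.comp (.cons (A.m p₂ _ rfl) p₃))).sum).sum

/-- The operations transported to the shifted morphism modules `s Hom`, by
`b ∘ (s ⊗ ⋯ ⊗ s) = s ∘ m`. -/
def bTot {X Y : Ob} (p : A.Chain X Y) : A.Tot X Y :=
  p.shiftSign.negOnePow • A.mTot p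

end AInftyData

/-- An `A_∞`-category over `k` (no units are part of the structure). -/
structure AInftyCategory (k : Type w) [CommRing k] (Ob : Type u) extends
    AInftyData.{u, v} k Ob where
  relation : ∀ {X Y : Ob} (p : toGradedQuiver.Chain X Y), toAInftyData.relationSum p = 0

namespace AInftyCategory

variable {k : Type w} [CommRing k] {Ob : Type u} (A : AInftyCategory.{u, v} k Ob)

/-- `m¹(x)`. -/
def m₁ {X Y : Ob} {d : ℤ} (x : A.Hom X Y d) (e : ℤ) (h : d + 1 = e) : A.Hom X Y e :=
  A.m (.cons x (.nil Y)) e (by simp only [Chain.deg, Chain.length]; omega)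

/-- `m²(y, x)`, the composite of `x : X → Y` and `y : Y → Z`. -/
def m₂ {X Y Z : Ob} {d d' : ℤ} (y : A.Hom Y Z d') (x : A.Hom X Y d) (e : ℤ)
    (h : d' + d = e) : A.Hom X Z e :=
  A.m (.cons x (.cons y (.nil Z))) e (by simp only [Chain.deg, Chain.length]; omega)

/-- A closed morphism of degree `0`. -/
def IsClosed {X Y : Ob} (f : A.Hom X Y 0) : Prop := A.m₁ f 1 rfl = 0

/-- Two morphisms of degree `0` are cohomologous if they differ by a coboundary. -/
def Cohomologous {X Y : Ob} (f g : A.Hom X Y 0) : Prop :=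
  ∃ h : A.Hom X Y (-1), f - g = A.m₁ h 0 rfl

/-- A family of degree `0` linear endomorphisms of the complex `Hom X Y` is homotopic to the
identity. -/
def HomotopicToId {X Y : Ob} (F : ∀ d, A.Hom X Y d → A.Hom X Y d) : Prop :=
  ∃ H : ∀ d d' : ℤ, d' + 1 = d → (A.Hom X Y d →ₗ[k] A.Hom X Y d'),
    ∀ (d : ℤ) (x : A.Hom X Y d),
      F d x - x = A.m₁ (H d (d - 1) (by omega) x) d (by omega) + H (d + 1) d rfl (A.m₁ x (d + 1) rfl)

/-- A unit of `X`: a closed degree `0` endomorphism `e` such that, for every `W`, the maps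
`m²(e, -)` on `Hom W X` and `m²(-, e)` on `Hom X W` are homotopic to the identity. -/
def IsUnit {X : Ob} (e : A.Hom X X 0) : Prop :=
  A.IsClosed e ∧
    (∀ W : Ob, A.HomotopicToId (X := W) (Y := X) fun d x => A.m₂ e x d (by omega)) ∧
    (∀ W : Ob, A.HomotopicToId (X := X) (Y := W) fun d x => A.m₂ x e d (by omega))

/-- Every object has a unit. -/
def IsUnital : Prop := ∀ X : Ob, ∃ e : A.Hom X X 0, A.IsUnit e

/-- `X` and `Y` are isomorphic in `H⁰(A)`, the category with the objects of `A`, the classes of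
closed degree `0` morphisms modulo coboundaries, the composition induced by `m²`, and the classes
of units as identities. -/
def IsomorphicInH0 (X Y : Ob) : Prop :=
  ∃ (a : A.Hom X Y 0) (b : A.Hom Y X 0), A.IsClosed a ∧ A.IsClosed b ∧
    (∃ e : A.Hom X X 0, A.IsUnit e ∧ A.Cohomologous (A.m₂ b a 0 rfl) e) ∧
    (∃ e : A.Hom Y Y 0, A.IsUnit e ∧ A.Cohomologous (A.m₂ a b 0 rfl) e)

/-- A formal direct sum of shifts `⨁ᵢ sⁿⁱ Xᵢ` with a strictly triangular endomorphism `δ` of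
degree `1`. Here `δ i j` is the component `sⁿⁱ Xᵢ → sⁿʲ Xⱼ`, and a morphism of degree `d` from
`sⁿ X` to `sᵐ Y` is an element of `Hom X Y` of degree `d + m - n`. -/
structure PreTwisted where
  r : ℕ
  obj : Fin r → Ob
  shift : Fin r → ℤ
  δ : ∀ i j, A.Hom (obj i) (obj j) (1 + shift j - shift i)
  triangular : ∀ i j, ¬ i < j → δ i j = 0

variable {A}

/-- All chains of components of `δ` from `i` to `j`, i.e. `(δ_{i₀ i₁}, …, δ_{i_{t-1} i_t})` with
`i = i₀ < i₁ < ⋯ < i_t = j` and `t ≥ 0`. -/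
def PreTwisted.dWords (T : A.PreTwisted) (i j : Fin T.r) : List (A.Chain (T.obj i) (T.obj j)) :=
  (if h : i = j then [h ▸ .nil (T.obj i)] else []) ++
    (List.finRange T.r).flatMap fun i' =>
      if _h : i < i' then (T.dWords i' j).map (.cons (T.δ i i')) else []
termination_by T.r - i.1
decreasing_by omega

variable (A)

/-- A twisted complex: `δ` satisfies the Maurer--Cartan equation `∑ₜ b(δ, …, δ) = 0`, that is
`∑ₜ (-1)^(t(t-1)/2) mᵗ(δ, …, δ) = 0` up to the signs from the shifts, which are the same for all
terms of a given component. -/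
structure TwistedComplex extends A.PreTwisted where
  maurerCartan : ∀ i j, ((toPreTwisted.dWords i j).map A.bTot).sum = 0

/-- The graded quiver of twisted complexes: morphisms are matrices. -/
def twQuiver : GradedQuiver.{max u v, v} k A.TwistedComplex where
  Hom T S d := ∀ (i : Fin T.r) (j : Fin S.r), A.Hom (T.obj i) (S.obj j) (d + S.shift j - T.shift i)
  addCommGroup _ _ _ := inferInstance
  module _ _ _ := inferInstance

variable {A}

/-- The chains of matrix components from `i` to `j` obtained from a chain `(z₁, …, zₙ)` of morphisms
of twisted complexes by inserting arbitrarily many `δ`s before, between and after the `z`s. -/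
def twWords : {T S : A.TwistedComplex} → (p : A.twQuiver.Chain T S) → (i : Fin T.r) →
    (j : Fin S.r) → List (A.Chain (T.obj i) (S.obj j))
  | T, _, .nil _, i, j => T.dWords i j
  | T, _, .cons (Y := U) z p, i, j =>
      (List.finRange T.r).flatMap fun a => (T.dWords i a).flatMap fun w =>
        (List.finRange U.r).flatMap fun b => (twWords p b j).map fun v =>
          w.comp (.cons (z a b) v)


theorem sum_flatMap {ι κ M : Type*} [AddCommMonoid M] (l : List ι) (f : ι → List κ) (F : κ → M) :
    ((l.flatMap f).map F).sum = (l.map fun x => ((f x).map F).sum).sum := by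
  induction l with
  | nil => simp
  | cons a l ih => simp [ih]

theorem sum_exchange {ι κ M : Type*} [AddCommMonoid M] (l : List ι) (l' : List κ) (F : ι → κ → M) :
    (l.map fun x => (l'.map fun y => F x y).sum).sum =
      (l'.map fun y => (l.map fun x => F x y).sum).sum := by
  induction l with
  | nil => simp
  | cons a l ih => simp [ih, List.sum_map_add]

theorem sum_congr {ι M : Type*} [AddCommMonoid M] {l : List ι} {F G : ι → M}
    (h : ∀ x ∈ l, F x = G x) : (l.map F).sum = (l.map G).sum := by
  rw [List.map_congr_left h]

theorem sum_hom {ι M N H : Type*} [AddCommMonoid M] [AddCommMonoid N] [FunLike H M N]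
    [AddMonoidHomClass H M N] (l : List ι) (F : ι → M) (g : H) : g (l.map F).sum = (l.map fun x => g (F x)).sum := by
  rw [map_list_sum, List.map_map]; rfl

theorem chain_comp_assoc {Q : GradedQuiver.{u, v} k Ob} {W X Y Z : Ob} (p : Q.Chain W X)
    (q : Q.Chain X Y) (r : Q.Chain Y Z) : (p.comp q).comp r = p.comp (q.comp r) := by
  induction p with
  | nil => rfl
  | cons x p ih => simp [Chain.comp, ih]

theorem length_comp {Q : GradedQuiver.{u, v} k Ob} {W X Y : Ob} (p : Q.Chain W X)
    (q : Q.Chain X Y) : (p.comp q).length = p.length + q.length := by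
  induction p with
  | nil => simp [Chain.comp, Chain.length]
  | cons x p ih => simp only [Chain.comp, Chain.length, ih]; ring

theorem deg_comp {Q : GradedQuiver.{u, v} k Ob} {W X Y : Ob} (p : Q.Chain W X)
    (q : Q.Chain X Y) : (p.comp q).deg = p.deg + q.deg := by
  induction p with
  | nil => simp [Chain.comp, Chain.deg]
  | cons x p ih => simp only [Chain.comp, Chain.deg, ih]; ring

theorem shiftSign_comp {Q : GradedQuiver.{u, v} k Ob} {W X Y : Ob} (p : Q.Chain W X)
    (q : Q.Chain X Y) : (p.comp q).shiftSign = p.shiftSign + q.shiftSign + p.length * q.deg := by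
  induction p with
  | nil => simp [Chain.comp, Chain.shiftSign, Chain.length]
  | cons x p ih => simp only [Chain.comp, Chain.shiftSign, Chain.length, ih, deg_comp]; ring

theorem comp_of_mem_splits {Q : GradedQuiver.{u, v} k Ob} {X Y : Ob} (p : Q.Chain X Y)
    (s : Σ Z, Q.Chain X Z × Q.Chain Z Y) (hs : s ∈ p.splits) : s.2.1.comp s.2.2 = p := by
  induction p with
  | nil => simp only [Chain.splits, List.mem_singleton] at hs; subst hs; rfl
  | cons x p ih =>
    simp only [Chain.splits, List.mem_cons, List.mem_map] at hs
    rcases hs with rfl | ⟨t, ht, rfl⟩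
    · rfl
    · simp [Chain.comp, ih t ht]

section words

variable {M : Type*} [AddCommMonoid M]

/-- Components of a concatenation `p · z · q`. -/
theorem sum_twWords_comp_cons : {T U V S : A.TwistedComplex} → (p : A.twQuiver.Chain T U) → {d : ℤ} →
    (z : A.twQuiver.Hom U V d) → (q : A.twQuiver.Chain V S) → (i : Fin T.r) → (j : Fin S.r) →
    (F : A.Chain (T.obj i) (S.obj j) → M) →
    ((twWords (p.comp (.cons z q)) i j).map F).sum =
      ((List.finRange U.r).map fun a => ((twWords p i a).map fun w =>
        ((List.finRange V.r).map fun b => ((twWords q b j).map fun v =>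
          F (w.comp (.cons (z a b) v))).sum).sum).sum).sum
  | T, _, V, S, .nil _, _, z, q, i, j, F => by
    simp only [Chain.comp, twWords, sum_flatMap, List.map_map, Function.comp_def]
  | T, U, V, S, .cons (Y := T') x p, _, z, q, i, j, F => by
    simp only [Chain.comp, twWords, sum_flatMap, List.map_map, Function.comp_def]
    symm
    rw [sum_exchange]
    refine sum_congr fun a _ => ?_
    rw [sum_exchange]
    refine sum_congr fun w _ => ?_
    rw [sum_exchange]
    refine sum_congr fun b _ => ?_
    simp only [chain_comp_assoc, Chain.comp]
    exact (sum_twWords_comp_cons p z q b j fun c => F (w.comp (.cons (x a b) c))).symm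

theorem sum_splits_comp_cons {Q : GradedQuiver.{u, v} k Ob} {W X Y Z : Ob} (p : Q.Chain W X) {d : ℤ}
    (x : Q.Hom X Y d) (q : Q.Chain Y Z) (G : ∀ V, Q.Chain W V → Q.Chain V Z → M) :
    (((p.comp (.cons x q)).splits).map fun s => G s.1 s.2.1 s.2.2).sum =
      (p.splits.map fun s => G s.1 s.2.1 (s.2.2.comp (.cons x q))).sum +
      (q.splits.map fun s => G s.1 (p.comp (.cons x s.2.1)) s.2.2).sum := by
  induction p with
  | nil => simp [Chain.comp, Chain.splits, Function.comp_def]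
  | cons y p ih =>
    simp only [Chain.comp, Chain.splits, List.map_cons, List.map_map, List.sum_cons,
      Function.comp_def, ih x fun V c c' => G V (.cons y c) c', add_assoc]

theorem sum_dWords (T : A.PreTwisted) (i j : Fin T.r) (F : A.Chain (T.obj i) (T.obj j) → M) :
    ((T.dWords i j).map F).sum = (if h : i = j then F (h ▸ .nil (T.obj i)) else 0) +
      ((List.finRange T.r).map fun i' =>
        if i < i' then ((T.dWords i' j).map fun w => F (.cons (T.δ i i') w)).sum else 0).sum := by
  rw [PreTwisted.dWords, List.map_append, List.sum_append, sum_flatMap]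
  congr 1
  · split <;> simp
  · refine sum_congr fun a _ => ?_
    split <;> simp [Function.comp_def]

theorem sum_ite_eq_finRange {r : ℕ} (i : Fin r) (F : ∀ a, i = a → M) :
    ((List.finRange r).map fun a => if h : i = a then F a h else 0).sum = F i rfl := by
  rw [← Fin.sum_univ_def, Finset.sum_eq_single i]
  · simp
  · intro b _ hb
    rw [dif_neg (Ne.symm hb)]
  · simp

/-- Splitting a chain of components of `δ`. -/
theorem sum_splits_dWords (T : A.PreTwisted) (i j : Fin T.r)
    (G : ∀ Z, A.Chain (T.obj i) Z → A.Chain Z (T.obj j) → M) :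
    ((T.dWords i j).map fun w => (w.splits.map fun s => G s.1 s.2.1 s.2.2).sum).sum =
      ((List.finRange T.r).map fun a => ((T.dWords i a).map fun w =>
        ((T.dWords a j).map fun v => G _ w v).sum).sum).sum := by
  rw [sum_dWords T i j]
  simp only [sum_dWords T i]
  rw [List.sum_map_add]
  have h₁ := sum_ite_eq_finRange i
    fun a (h : i = a) => ((T.dWords a j).map fun v => G _ (h ▸ .nil (T.obj i)) v).sum
  rw [h₁, sum_dWords T i j, add_assoc]
  congr 1
  · split
    · next h => subst h; simp [Chain.splits]
    · rfl
  · rw [sum_exchange, ← List.sum_map_add]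
    refine sum_congr fun a _ => ?_
    split
    · next h =>
      have ih := sum_splits_dWords T a j fun Z c c' => G Z (.cons (T.δ i a) c) c'
      simp only [Chain.splits, List.map_cons, List.map_map, List.sum_cons, Function.comp_def,
        List.sum_map_add, ih]
    · simp
termination_by T.r - i.1

/-- Splitting the components of a chain. -/
theorem sum_splits_twWords : {T S : A.TwistedComplex} → (p : A.twQuiver.Chain T S) →
    (i : Fin T.r) → (j : Fin S.r) →
    (G : ∀ Z, A.Chain (T.obj i) Z → A.Chain Z (S.obj j) → M) →
    ((twWords p i j).map fun w => (w.splits.map fun s => G s.1 s.2.1 s.2.2).sum).sum =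
      (p.splits.map fun s => ((List.finRange s.1.r).map
        fun a => ((twWords s.2.1 i a).map fun w =>
          ((twWords s.2.2 a j).map fun v => G _ w v).sum).sum).sum).sum
  | T, _, .nil _, i, j, G => by
    simp only [Chain.splits, twWords, List.map_cons, List.map_nil, List.sum_cons, List.sum_nil,
      add_zero]
    exact sum_splits_dWords _ i j G
  | T, S, .cons (Y := T') x p, i, j, G => by
    simp only [Chain.splits, twWords, sum_flatMap, List.map_map, List.map_cons, List.sum_cons,
      Function.comp_def, sum_splits_comp_cons, List.sum_map_add]
    congr 1
    · symm
      refine (sum_congr fun a' _ => sum_exchange _ _ _).trans ?_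
      rw [sum_exchange]
      refine sum_congr fun a _ => ?_
      symm
      have h := sum_splits_dWords T.toPreTwisted i a fun Z c c' =>
        ((List.finRange T'.r).map fun b =>
          ((twWords p b j).map fun v => G Z c (c'.comp (.cons (x a b) v))).sum).sum
      refine Eq.trans (sum_congr fun w _ => ?_) (h.trans (sum_congr fun a' _ => ?_))
      · rw [sum_exchange]
        refine sum_congr fun b _ => ?_
        rw [sum_exchange]
      · rfl
    · symm
      refine (sum_congr fun s _ => (sum_exchange _ _ _).trans
        (sum_congr fun a _ => sum_exchange _ _ _)).trans ?_
      rw [sum_exchange]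
      refine sum_congr fun a _ => ?_
      rw [sum_exchange]
      refine sum_congr fun w _ => ?_
      refine (sum_congr fun s _ => (sum_exchange _ _ _)).trans ?_
      rw [sum_exchange]
      refine sum_congr fun b _ => ?_
      exact (sum_splits_twWords p b j fun Z c c' => G Z (w.comp (.cons (x a b) c)) c').symm

end words

section data

variable (D : AInftyData.{u, v} k Ob)

theorem negOnePow_congr {a b : ℤ} (c : ℤ) (h : a = b + 2 * c) : a.negOnePow = b.negOnePow := by
  rw [h, Int.negOnePow_add, Int.negOnePow_two_mul, mul_one]

theorem map_unit_smul {M N F : Type*} [AddCommGroup M] [AddCommGroup N] [FunLike F M N]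
    [AddMonoidHomClass F M N] (g : F) (ε : ℤˣ) (x : M) : g (ε • x) = ε • g x := by
  rw [Units.smul_def, Units.smul_def, map_zsmul]

theorem mTot_eq {X Y : Ob} (p : D.Chain X Y) (e : ℤ) (h : p.deg + 2 - p.length = e) :
    D.mTot p = DirectSum.of (D.Hom X Y) e (D.m p e h) := by
  subst h; rfl

theorem bTot_add {W X Y Z : Ob} (p : D.Chain W X) {d : ℤ} (x y : D.Hom X Y d)
    (q : D.Chain Y Z) :
    D.bTot (p.comp (.cons (x + y) q)) = D.bTot (p.comp (.cons x q)) + D.bTot (p.comp (.cons y q)) := by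
  have h (z : D.Hom X Y d) : (p.comp (.cons z q)).deg + 2 - (p.comp (.cons z q)).length =
      p.deg + (d + q.deg) + 2 - (p.length + (q.length + 1)) := by
    simp only [deg_comp, length_comp, Chain.deg, Chain.length]
  simp only [AInftyData.bTot, mTot_eq D _ _ (h _), shiftSign_comp, Chain.shiftSign, Chain.deg]
  rw [← smul_add, ← map_add, D.m_add]

theorem bTot_smul {W X Y Z : Ob} (p : D.Chain W X) {d : ℤ} (c : k) (x : D.Hom X Y d)
    (q : D.Chain Y Z) :
    D.bTot (p.comp (.cons (c • x) q)) = c • D.bTot (p.comp (.cons x q)) := by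
  have h (z : D.Hom X Y d) : (p.comp (.cons z q)).deg + 2 - (p.comp (.cons z q)).length =
      p.deg + (d + q.deg) + 2 - (p.length + (q.length + 1)) := by
    simp only [deg_comp, length_comp, Chain.deg, Chain.length]
  simp only [AInftyData.bTot, mTot_eq D _ _ (h _), shiftSign_comp, Chain.shiftSign, Chain.deg]
  rw [smul_comm, D.m_smul p c x q _ (h _) (h _)]
  congr 1
  exact (DirectSum.lof k ℤ (D.Hom W Z) _).map_smul c _

/-- `x ↦ b(w₃, x, w₁)` on the total module. -/
def slot {W X Y Z : Ob} (p : D.Chain W X) (q : D.Chain Y Z) : D.Tot X Y →ₗ[k] D.Tot W Z :=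
  DirectSum.toModule k ℤ _ fun d =>
    { toFun := fun x : D.Hom X Y d => D.bTot (p.comp (.cons x q))
      map_add' := fun x y => bTot_add D p x y q
      map_smul' := fun c x => bTot_smul D p c x q }

theorem slot_of {W X Y Z : Ob} (p : D.Chain W X) (q : D.Chain Y Z) {d : ℤ} (x : D.Hom X Y d) :
    slot D p q (DirectSum.of _ d x) = D.bTot (p.comp (.cons x q)) :=
  DirectSum.toModule_lof k (φ := fun d =>
    { toFun := fun x : D.Hom X Y d => D.bTot (p.comp (.cons x q))
      map_add' := fun x y => bTot_add D p x y q
      map_smul' := fun c x => bTot_smul D p c x q }) d x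

/-- The `A_∞`-relation in terms of the shifted operations. -/
theorem shiftSign_smul_relationSum {X Y : Ob} (p : D.Chain X Y) :
    p.shiftSign.negOnePow • D.relationSum p =
      (p.splits.map fun s => (s.2.2.splits.map fun t =>
        (t.2.2.deg - t.2.2.length).negOnePow • slot D s.2.1 t.2.2 (D.bTot t.2.1)).sum).sum := by
  rw [AInftyData.relationSum, List.smul_sum, List.map_map]
  refine sum_congr fun s hs => ?_
  rw [Function.comp_apply, List.smul_sum, List.map_map]
  refine sum_congr fun t ht => ?_
  rw [Function.comp_apply, ← comp_of_mem_splits p s hs, ← comp_of_mem_splits _ t ht]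
  rw [AInftyData.bTot, AInftyData.mTot, map_unit_smul, slot_of, AInftyData.bTot]
  simp only [smul_smul, ← Int.negOnePow_add]
  congr 1
  simp only [shiftSign_comp, Chain.shiftSign, deg_comp, Chain.deg]
  refine negOnePow_congr (s.2.1.length * (t.2.1.length - 1) +
    t.2.1.length * t.2.2.deg + t.2.2.length - t.2.2.deg) ?_
  ring

end data

/-- The sum of the shifted operations over all ways of inserting `δ`s. -/
def twSum {T S : A.TwistedComplex} (p : A.twQuiver.Chain T S) (i : Fin T.r) (j : Fin S.r) :
    A.Tot (T.obj i) (S.obj j) :=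
  ((twWords p i j).map A.bTot).sum

theorem twSum_comp_cons {T U V S : A.TwistedComplex} (p : A.twQuiver.Chain T U) {d : ℤ}
    (z : A.twQuiver.Hom U V d) (q : A.twQuiver.Chain V S) (i : Fin T.r) (j : Fin S.r) :
    twSum (p.comp (.cons z q)) i j =
      ((List.finRange U.r).map fun a => ((twWords p i a).map fun w =>
        ((List.finRange V.r).map fun b => ((twWords q b j).map fun v =>
          slot A.toAInftyData w v (DirectSum.of _ _ (z a b))).sum).sum).sum).sum := by
  simp only [twSum, sum_twWords_comp_cons, slot_of]

theorem twSum_add {T U V S : A.TwistedComplex} (p : A.twQuiver.Chain T U) {d : ℤ}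
    (x y : A.twQuiver.Hom U V d) (q : A.twQuiver.Chain V S) (i : Fin T.r) (j : Fin S.r) :
    twSum (p.comp (.cons (x + y) q)) i j =
      twSum (p.comp (.cons x q)) i j + twSum (p.comp (.cons y q)) i j := by
  simp only [twSum_comp_cons, ← List.sum_map_add]
  refine sum_congr fun a _ => sum_congr fun w _ => sum_congr fun b _ => sum_congr fun v _ => ?_
  rw [← map_add, ← map_add]
  rfl

theorem twSum_smul {T U V S : A.TwistedComplex} (p : A.twQuiver.Chain T U) {d : ℤ} (c : k)
    (x : A.twQuiver.Hom U V d) (q : A.twQuiver.Chain V S) (i : Fin T.r) (j : Fin S.r) :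
    twSum (p.comp (.cons (c • x) q)) i j = c • twSum (p.comp (.cons x q)) i j := by
  simp only [twSum_comp_cons, List.smul_sum, List.map_map, Function.comp_def]
  refine sum_congr fun a _ => sum_congr fun w _ => sum_congr fun b _ => sum_congr fun v _ => ?_
  rw [← LinearMap.map_smul]
  congr 1
  exact (DirectSum.lof k ℤ (A.Hom (U.obj a) (V.obj b)) _).map_smul c _

theorem reduced_deg_of_mem_dWords (T : A.PreTwisted) (i j : Fin T.r)
    (w : A.Chain (T.obj i) (T.obj j)) (hw : w ∈ T.dWords i j) :
    w.deg - w.length = T.shift j - T.shift i := by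
  rw [PreTwisted.dWords, List.mem_append, List.mem_flatMap] at hw
  rcases hw with hw | ⟨a, -, hw⟩
  · split at hw
    · next h =>
      subst h
      rw [List.mem_singleton] at hw
      subst hw
      simp [Chain.deg, Chain.length]
    · simp at hw
  · split at hw
    · next h =>
      rw [List.mem_map] at hw
      obtain ⟨v, hv, rfl⟩ := hw
      have := reduced_deg_of_mem_dWords T a j v hv
      simp only [Chain.deg, Chain.length]
      omega
    · simp at hw
termination_by T.r - i.1

theorem reduced_deg_of_mem_twWords : {T S : A.TwistedComplex} → (p : A.twQuiver.Chain T S) →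
    (i : Fin T.r) → (j : Fin S.r) → (w : A.Chain (T.obj i) (S.obj j)) → (hw : w ∈ twWords p i j) →
    w.deg - w.length = p.deg - p.length + S.shift j - T.shift i
  | T, _, .nil _, i, j, w, hw => by
    have := reduced_deg_of_mem_dWords T.toPreTwisted i j w hw
    simp only [Chain.deg, Chain.length]
    omega
  | T, S, .cons (Y := T') x p, i, j, w, hw => by
    simp only [twWords, List.mem_flatMap, List.mem_map] at hw
    obtain ⟨a, -, w, hw, b, -, v, hv, rfl⟩ := hw
    have h₁ := reduced_deg_of_mem_dWords T.toPreTwisted i a w hw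
    have h₂ := reduced_deg_of_mem_twWords p b j v hv
    simp only [Chain.deg, Chain.length, deg_comp, length_comp]
    omega

/-- All terms of `twSum` lie in a single degree. -/
theorem of_twSum {T S : A.TwistedComplex} (p : A.twQuiver.Chain T S) (i : Fin T.r) (j : Fin S.r)
    (e : ℤ) (he : e = p.deg + 2 - p.length + S.shift j - T.shift i) :
    DirectSum.of (A.Hom (T.obj i) (S.obj j)) e (twSum p i j e) = twSum p i j := by
  have key : ∀ l : List (A.Chain (T.obj i) (S.obj j)), (∀ w ∈ l, w.deg + 2 - w.length = e) →
      ∃ x, (l.map A.bTot).sum = DirectSum.of (A.Hom (T.obj i) (S.obj j)) e x := by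
    intro l
    induction l with
    | nil => exact fun _ => ⟨0, by simp⟩
    | cons w l ih =>
      intro h
      obtain ⟨x, hx⟩ := ih fun v hv => h v (List.mem_cons_of_mem _ hv)
      refine ⟨w.shiftSign.negOnePow • A.m w e (h w List.mem_cons_self) + x, ?_⟩
      rw [List.map_cons, List.sum_cons, hx, map_add, map_unit_smul, AInftyData.bTot,
        mTot_eq A.toAInftyData w e (h w List.mem_cons_self)]
  obtain ⟨x, hx⟩ := key (twWords p i j) fun w hw => by
    have := reduced_deg_of_mem_twWords p i j w hw
    omega
  rw [twSum, hx, DirectSum.of_eq_same]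

/-- The operations on twisted complexes. In terms of the shifted operations they are
`b^Tw(zₙ, …, z₁) = ∑ b(δ, …, δ, zₙ, δ, …, δ, z₁, δ, …, δ)` with the sign `(-1)^m` on the components
with target `sᵐ Y`. (The Koszul rule for `b` on tensor products `φ ⊗ x`, `φ : sⁿ k → sᵐ k`, gives
exactly this after multiplying `x : sⁿ X → sᵐ Y` by `(-1)^(n (|x| - 1))`, `|x|` the degree of `x`
in `Hom X Y`.) -/
def twM {T S : A.TwistedComplex} (p : A.twQuiver.Chain T S) (e : ℤ) : A.twQuiver.Hom T S e :=
  fun i j => (p.shiftSign + S.shift j).negOnePow • (twSum p i j) (e + S.shift j - T.shift i)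

variable (A)

/-- The graded quiver of twisted complexes with its operations. -/
abbrev twData : AInftyData.{max u v, v} k A.TwistedComplex where
  toGradedQuiver := A.twQuiver
  m p e _ := twM p e
  m_nil T e _ := by
    funext i j
    rw [twM, twSum, twWords, TwistedComplex.maurerCartan]
    exact smul_zero _
  m_add p _ x y q e _ _ _ := by
    funext i j
    rw [twM, twSum_add, DirectSum.add_apply, smul_add]
    change _ = twM _ e i j + twM _ e i j
    simp only [twM, shiftSign_comp, Chain.shiftSign, Chain.deg]
  m_smul p _ c x q e _ _ := by
    funext i j
    rw [twM, twSum_smul, DirectSum.smul_apply, smul_comm]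
    change _ = c • twM _ e i j
    simp only [twM, shiftSign_comp, Chain.shiftSign, Chain.deg]

variable {A}

/-- The matrix component of an element of the total module. -/
def entry {T S : A.TwistedComplex} (i : Fin T.r) (j : Fin S.r) :
    A.twQuiver.Tot T S →+ A.Tot (T.obj i) (S.obj j) :=
  DirectSum.toAddMonoid fun d =>
    { toFun := fun z : A.twQuiver.Hom T S d =>
        DirectSum.of (A.Hom (T.obj i) (S.obj j)) (d + S.shift j - T.shift i) (z i j)
      map_zero' := map_zero _
      map_add' := fun _ _ => map_add _ _ _ }

theorem entry_of {T S : A.TwistedComplex} (i : Fin T.r) (j : Fin S.r) {d : ℤ}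
    (z : A.twQuiver.Hom T S d) : entry i j (DirectSum.of _ d z) = DirectSum.of _ _ (z i j) :=
  DirectSum.toAddMonoid_of _ _ _

theorem entry_apply {T S : A.TwistedComplex} (i : Fin T.r) (j : Fin S.r)
    (x : A.twQuiver.Tot T S) (d : ℤ) :
    entry i j x (d + S.shift j - T.shift i) = x d i j := by
  induction x using DirectSum.induction_on with
  | zero => rw [map_zero]; rfl
  | of e z =>
    rw [entry_of]
    by_cases h : e = d
    · subst h
      rw [DirectSum.of_eq_same, DirectSum.of_eq_same]
    · rw [DirectSum.of_eq_of_ne _ _ _ (by omega), DirectSum.of_eq_of_ne _ _ _ (Ne.symm h)]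
      rfl
  | add x y hx hy => rw [map_add, DirectSum.add_apply, DirectSum.add_apply, hx, hy]; rfl

theorem entry_bTot {T S : A.TwistedComplex} (i : Fin T.r) (j : Fin S.r)
    (p : A.twQuiver.Chain T S) :
    entry i j (A.twData.bTot p) = (S.shift j).negOnePow • twSum p i j := by
  have h : A.twData.bTot p = p.shiftSign.negOnePow •
      DirectSum.of (A.twQuiver.Hom T S) (p.deg + 2 - p.length) (twM p _) := rfl
  rw [h, map_unit_smul, entry_of, ← of_twSum p i j _ rfl, ← map_unit_smul, ← map_unit_smul]
  congr 1
  simp only [twM, smul_smul, ← Int.negOnePow_add]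
  congr 1
  exact negOnePow_congr p.shiftSign (by ring)

theorem entry_slot {T U V S : A.TwistedComplex} (i : Fin T.r) (j : Fin S.r)
    (p : A.twQuiver.Chain T U) (q : A.twQuiver.Chain U V) (r : A.twQuiver.Chain V S) :
    entry i j (slot A.twData p r (A.twData.bTot q)) =
      ((List.finRange U.r).map fun a => ((twWords p i a).map fun w =>
        ((List.finRange V.r).map fun b => ((twWords r b j).map fun v =>
          (S.shift j + V.shift b).negOnePow •
            slot A.toAInftyData w v (twSum q a b)).sum).sum).sum).sum := by
  have h : A.twData.bTot q = DirectSum.of (A.twQuiver.Hom U V) (q.deg + 2 - q.length)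
      (q.shiftSign.negOnePow • twM q _) := (map_unit_smul _ _ _).symm
  have h' (a : Fin U.r) (b : Fin V.r) : DirectSum.of (A.Hom (U.obj a) (V.obj b)) _
      ((q.shiftSign.negOnePow • twM q (q.deg + 2 - q.length) : A.twQuiver.Hom U V _) a b) =
        (V.shift b).negOnePow • twSum q a b := by
    rw [← entry_bTot, h, entry_of]
  rw [h]
  refine (congrArg _ (slot_of A.twData p r _)).trans ?_
  rw [entry_bTot, twSum_comp_cons]
  simp only [List.smul_sum, List.map_map, Function.comp_def]
  refine sum_congr fun a _ => sum_congr fun w _ => sum_congr fun b _ => sum_congr fun v _ => ?_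
  rw [h', map_unit_smul, smul_smul, ← Int.negOnePow_add]

theorem entry_relation {T S : A.TwistedComplex} (p : A.twQuiver.Chain T S) (i : Fin T.r)
    (j : Fin S.r) : entry i j (p.shiftSign.negOnePow • A.twData.relationSum p) = 0 := by
  refine (congrArg (entry i j) (shiftSign_smul_relationSum A.twData p)).trans ?_
  have h₀ : ((twWords p i j).map fun w => (w.splits.map fun s => (s.2.2.splits.map fun t =>
      (t.2.2.deg - t.2.2.length).negOnePow •
        slot A.toAInftyData s.2.1 t.2.2 (A.bTot t.2.1)).sum).sum).sum = 0 := by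
    simp only [← shiftSign_smul_relationSum, A.relation, smul_zero, List.map_const',
      List.sum_replicate]
  rw [sum_splits_twWords p i j fun Z c c' => (c'.splits.map fun t =>
      (t.2.2.deg - t.2.2.length).negOnePow •
        slot A.toAInftyData c t.2.2 (A.bTot t.2.1)).sum] at h₀
  rw [← h₀, sum_hom]
  refine sum_congr fun s _ => ?_
  rw [sum_hom]
  symm
  refine (sum_congr fun a _ => (sum_congr fun w _ => sum_splits_twWords s.2.2 a j fun Z c c' =>
    (c'.deg - c'.length).negOnePow • slot A.toAInftyData w c' (A.bTot c)).trans
      (sum_exchange _ _ _)).trans ?_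
  rw [sum_exchange]
  refine sum_congr fun t _ => ?_
  rw [map_unit_smul, entry_slot]
  simp only [List.smul_sum, List.map_map, Function.comp_def]
  refine sum_congr fun a _ => sum_congr fun w _ => sum_congr fun b _ => ?_
  rw [sum_exchange]
  refine sum_congr fun v hv => ?_
  have h := reduced_deg_of_mem_twWords t.2.2 b j v hv
  rw [twSum, sum_hom, List.smul_sum, List.smul_sum, List.map_map, List.map_map]
  refine sum_congr fun c _ => ?_
  simp only [Function.comp_def, smul_smul, ← Int.negOnePow_add]
  congr 1
  exact negOnePow_congr (- t.1.shift b) (by omega)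

theorem twData_relation {T S : A.TwistedComplex} (p : A.twQuiver.Chain T S) :
    A.twData.relationSum p = 0 := by
  have h : p.shiftSign.negOnePow • A.twData.relationSum p = 0 := by
    refine DFinsupp.ext fun d => ?_
    funext i j
    have h := congrArg (fun x : A.Tot (T.obj i) (S.obj j) => x (d + S.shift j - T.shift i))
      (entry_relation p i j)
    exact (entry_apply i j _ d).symm.trans h
  have h' := congrArg (p.shiftSign.negOnePow • ·) h
  simpa only [smul_smul, Int.units_mul_self, one_smul, smul_zero] using h'

variable (A)

/-- The `A_∞`-category of twisted complexes. -/
def Tw : AInftyCategory.{max u v, v} k A.TwistedComplex where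
  toAInftyData := A.twData
  relation := twData_relation

variable {A}

/-- The graded object `s X ⊕ Y` where `δ` has the single component `f : s X → Y`. -/
def preCone {X Y : Ob} (f : A.Hom X Y 0) : A.PreTwisted where
  r := 2
  obj := ![X, Y]
  shift := ![1, 0]
  δ i j := match i, j with
    | 0, 1 => f
    | 0, 0 => 0
    | 1, 0 => 0
    | 1, 1 => 0
  triangular := by
    intro i j h
    fin_cases i <;> fin_cases j <;> first | rfl | exact absurd (by decide) h

theorem dWords_preCone {X Y : Ob} (f : A.Hom X Y 0) :
    (preCone f).dWords (0 : Fin 2) (0 : Fin 2) = [.nil X] ∧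
    (preCone f).dWords (0 : Fin 2) (1 : Fin 2) = [.cons f (.nil Y)] ∧
    (preCone f).dWords (1 : Fin 2) (0 : Fin 2) = [] ∧
    (preCone f).dWords (1 : Fin 2) (1 : Fin 2) = [.nil Y] := by
  have h₁ : (preCone f).dWords (1 : Fin 2) (1 : Fin 2) = [.nil Y] :=
    PreTwisted.dWords.eq_1 (preCone f) (1 : Fin 2) (1 : Fin 2)
  have h₂ : (preCone f).dWords (1 : Fin 2) (0 : Fin 2) = [] :=
    PreTwisted.dWords.eq_1 (preCone f) (1 : Fin 2) (0 : Fin 2)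
  refine ⟨?_, ?_, h₂, h₁⟩
  · refine (PreTwisted.dWords.eq_1 (preCone f) (0 : Fin 2) (0 : Fin 2)).trans ?_
    change [_] ++ ([] ++ (((preCone f).dWords (1 : Fin 2) (0 : Fin 2)).map _ ++ [])) = _
    rw [h₂]; rfl
  · refine (PreTwisted.dWords.eq_1 (preCone f) (0 : Fin 2) (1 : Fin 2)).trans ?_
    change [] ++ ([] ++ (((preCone f).dWords (1 : Fin 2) (1 : Fin 2)).map _ ++ [])) = _
    rw [h₁]; rfl

/-- The mapping cone of a closed morphism `f` of degree `0`. -/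
def cone {X Y : Ob} (f : A.Hom X Y 0) (hf : A.IsClosed f) : A.TwistedComplex where
  toPreTwisted := preCone f
  maurerCartan := by
    have h₁ (Z : Ob) : A.bTot (.nil Z) = 0 := by
      rw [AInftyData.bTot, AInftyData.mTot, A.m_nil, map_zero, smul_zero]
    have h₂ : A.bTot (.cons f (.nil Y)) = 0 := by
      rw [AInftyData.bTot, mTot_eq A.toAInftyData _ 1 rfl]
      refine (congrArg _ (congrArg _ hf)).trans ?_
      rw [map_zero, smul_zero]
    obtain ⟨h₀₀, h₀₁, h₁₀, h₁₁⟩ := dWords_preCone f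
    intro (i : Fin 2) (j : Fin 2)
    fin_cases i <;> fin_cases j
    · exact (congrArg (fun l => (l.map A.bTot).sum) h₀₀).trans
        ((add_zero _).trans (h₁ X))
    · exact (congrArg (fun l => (l.map A.bTot).sum) h₀₁).trans
        ((add_zero _).trans h₂)
    · exact congrArg (fun l => (l.map A.bTot).sum) h₁₀
    · exact (congrArg (fun l => (l.map A.bTot).sum) h₁₁).trans
        ((add_zero _).trans (h₁ Y))

end AInftyCategory

/-! The isomorphism is a matrix `z` from `cone f` to `cone g` with diagonal entries `-e` and `e'`,
for units `e` of `X` and `e'` of `Y`, with entry `0` from `Y` to `sX` and an entry `u` of degree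
`-1` from `sX` to `Y`. Closedness of `z` reduces to `-m²(g, e) + m¹(u) + m²(e', f) = 0`. This is
solvable (`exists_off_diagonal`): `m²(g, e)` is cohomologous to `g`, `m²(e', f)` to `f`, and `f` to
`g`. The sign of `-e` comes from the shift of `X`; it makes the two classes cancel instead of add.

It remains to see that `z` is invertible in cohomology, without first proving that `Tw A` is unital.
Left and right multiplication by `z` on the morphism complexes of `Tw A` are triangular with respect
to matrix entries (`hasDiag_mulLeft`, `hasDiag_mulRight`), and so are the differentials
(`hasDiag_diff`). On the diagonal, multiplication by `z` is multiplication by `e` or `e'` in `A`,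
which is homotopic to the identity. A triangular chain map with such a diagonal is a homotopy
equivalence (`HtpyEquiv.of_hasDiag`): subtracting the boundary of the diagonal homotopy leaves a
unipotent, hence bijective, chain map.

Finally, a closed morphism `a` of degree `0` that acts by homotopy equivalences on both sides is an
isomorphism in `H⁰` (`isomorphicInH0_of_htpyEquiv`). Solving `a e ≃ a`, `e' a ≃ a` and `a b ≃ e'` in
cohomology produces candidates for units and inverse. That `e` and `e'` are units, and that `b a ≃
e`, follows by cancelling `a`, using associativity of `m²` up to the homotopy `m³`.

Homotopies are taken between linear maps of ungraded total modules. Nothing is lost, because the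
component of the required degree can be extracted at the end. -/

/-! ### Homotopies between maps of differential modules. -/

section Homotopy

variable {k : Type*} [CommRing k] {M N : Type*} [AddCommGroup M] [Module k M]
  [AddCommGroup N] [Module k N]

/-- Two maps of differential modules are homotopic. -/
def Htpic (D : M →ₗ[k] M) (D' : N →ₗ[k] N) (F F' : M →ₗ[k] N) : Prop :=
  ∃ H : M →ₗ[k] N, ∀ x, F x - F' x = D' (H x) + H (D x)

/-- A map of differential modules has a homotopy inverse. -/
def HtpyEquiv (D : M →ₗ[k] M) (D' : N →ₗ[k] N) (F : M →ₗ[k] N) : Prop :=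
  ∃ G : N →ₗ[k] M, (∀ y, D (G y) = G (D' y)) ∧ Htpic D D (G ∘ₗ F) .id ∧ Htpic D' D' (F ∘ₗ G) .id

theorem Htpic.trans {D : M →ₗ[k] M} {D' : N →ₗ[k] N} {F F' F'' : M →ₗ[k] N}
    (h : Htpic D D' F F') (h' : Htpic D D' F' F'') : Htpic D D' F F'' := by
  obtain ⟨H, hH⟩ := h
  obtain ⟨H', hH'⟩ := h'
  refine ⟨H + H', fun x => ?_⟩
  rw [← sub_add_sub_cancel _ (F' x), hH, hH']
  simp only [LinearMap.add_apply, map_add]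
  abel

theorem Htpic.symm {D : M →ₗ[k] M} {D' : N →ₗ[k] N} {F F' : M →ₗ[k] N}
    (h : Htpic D D' F F') : Htpic D D' F' F := by
  obtain ⟨H, hH⟩ := h
  refine ⟨-H, fun x => ?_⟩
  rw [← neg_sub, hH]
  simp only [LinearMap.neg_apply, map_neg]
  abel

/-- Homotopy equivalences can be cancelled on the left. -/
theorem HtpyEquiv.cancel_left {D : M →ₗ[k] M} {D' : N →ₗ[k] N} {F : M →ₗ[k] N}
    (hF : HtpyEquiv D D' F) {E : M →ₗ[k] M} (hE : ∀ x, D (E x) = E (D x))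
    (h : Htpic D D' (F ∘ₗ E) F) : Htpic D D E .id := by
  obtain ⟨G, hG, h₁, -⟩ := hF
  -- The chain of homotopies is `E ≃ G F E ≃ G F ≃ id`.
  have h₂ : Htpic D D (G ∘ₗ F ∘ₗ E) (G ∘ₗ F) := by
    obtain ⟨H, hH⟩ := h
    refine ⟨G ∘ₗ H, fun x => ?_⟩
    simp only [LinearMap.comp_apply] at hH ⊢
    rw [← map_sub, hH, map_add, hG]
  have h₃ : Htpic D D (G ∘ₗ F ∘ₗ E) E := by
    obtain ⟨H, hH⟩ := h₁
    refine ⟨H ∘ₗ E, fun x => ?_⟩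
    have := hH (E x)
    simpa only [LinearMap.comp_apply, LinearMap.id_apply, hE] using this
  exact h₃.symm.trans (h₂.trans h₁)

/-- Homotopy equivalences can be cancelled on the right. -/
theorem HtpyEquiv.cancel_right {D : M →ₗ[k] M} {D' : N →ₗ[k] N} {F : M →ₗ[k] N}
    (hF : HtpyEquiv D D' F) {E : N →ₗ[k] N} (hE : ∀ x, D' (E x) = E (D' x))
    (h : Htpic D D' (E ∘ₗ F) F) : Htpic D' D' E .id := by
  obtain ⟨G, hG, -, h₁⟩ := hF
  have h₂ : Htpic D' D' (E ∘ₗ F ∘ₗ G) (F ∘ₗ G) := by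
    obtain ⟨H, hH⟩ := h
    refine ⟨H ∘ₗ G, fun x => ?_⟩
    have := hH (G x)
    simpa only [LinearMap.comp_apply, hG] using this
  have h₃ : Htpic D' D' (E ∘ₗ F ∘ₗ G) E := by
    obtain ⟨H, hH⟩ := h₁
    refine ⟨E ∘ₗ H, fun x => ?_⟩
    have := congrArg E (hH x)
    simpa only [LinearMap.comp_apply, LinearMap.id_apply, map_sub, map_add, hE] using this
  exact h₃.symm.trans (h₂.trans h₁)

/-! ### Triangular maps and their diagonals. -/

section Triangular

variable {P : Type*} [AddCommGroup P] [Module k P] {ι : Type*} {Q : ι → Type*}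
  [∀ p, AddCommGroup (Q p)] [∀ p, Module k (Q p)]

/-- With respect to decompositions of source and target and the order on the summands given by `ρ`,
`T` is triangular with diagonal `t`. -/
def HasDiag (ρ : ι → ℕ) (Φ : M ≃ₗ[k] ∀ p, Q p) (Ψ : N ≃ₗ[k] ∀ p, Q p) (T : M →ₗ[k] N)
    (t : ∀ p, Q p →ₗ[k] Q p) : Prop :=
  ∀ z p, (∀ q, ρ q < ρ p → Φ z q = 0) → Ψ (T z) p = t p (Φ z p)

variable {ρ : ι → ℕ} {Φ : M ≃ₗ[k] ∀ p, Q p} {Ψ : N ≃ₗ[k] ∀ p, Q p} {Ξ : P ≃ₗ[k] ∀ p, Q p}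

/-- If `z` vanishes in all ranks below that of `p`, then so does `T z`: each such entry is given by
the diagonal of `T` applied to a zero entry of `z`. Hence the diagonal description of `T'` applies
to `T z`. -/
theorem HasDiag.comp {T : M →ₗ[k] N} {T' : N →ₗ[k] P} {t t' : ∀ p, Q p →ₗ[k] Q p}
    (h' : HasDiag ρ Ψ Ξ T' t') (h : HasDiag ρ Φ Ψ T t) :
    HasDiag ρ Φ Ξ (T' ∘ₗ T) fun p => t' p ∘ₗ t p := by
  intro z p hz
  have := h' (T z) p fun q hq => by
    rw [h z q fun r hr => hz r (hr.trans hq), hz q hq, map_zero]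
  simp only [LinearMap.comp_apply]
  rw [this, h z p hz]

theorem HasDiag.sub {T T' : M →ₗ[k] N} {t t' : ∀ p, Q p →ₗ[k] Q p}
    (h : HasDiag ρ Φ Ψ T t) (h' : HasDiag ρ Φ Ψ T' t') :
    HasDiag ρ Φ Ψ (T - T') fun p => t p - t' p := by
  intro z p hz
  simp only [LinearMap.sub_apply, map_sub, Pi.sub_apply, h z p hz, h' z p hz]

theorem hasDiag_piMap (h : ∀ p, Q p →ₗ[k] Q p) :
    HasDiag ρ Φ Ψ (Ψ.symm.toLinearMap ∘ₗ LinearMap.piMap h ∘ₗ Φ.toLinearMap) h := by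
  intro z p _
  simp

/-- A triangular endomorphism with diagonal the identity is invertible. -/
theorem HasDiag.isUnit [Finite ι] {T : M →ₗ[k] M} (h : HasDiag ρ Φ Φ T fun _ => .id) :
    IsUnit T := by
  have hT : IsNilpotent (T - 1) := by
    -- Each application of `T - 1` kills the lowest surviving rank; finiteness of `ι` bounds the
    -- ranks.
    have key (n : ℕ) (z : M) : ∀ p, ρ p < n → Φ (((T - 1) ^ n) z) p = 0 := by
      induction n with
      | zero => intro p hp; omega
      | succ n ih =>
        intro p hp
        rw [pow_succ', Module.End.mul_apply, LinearMap.sub_apply, map_sub, Pi.sub_apply,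
          h _ p fun q hq => ih q (by omega)]
        simp
    obtain ⟨n, hn⟩ := (Set.finite_range ρ).bddAbove
    refine ⟨n + 1, LinearMap.ext fun z => Φ.injective (funext fun p => ?_)⟩
    rw [key (n + 1) z p (Nat.lt_succ_of_le (hn ⟨p, rfl⟩))]
    simp
  have := hT.isUnit_one_add
  rwa [add_sub_cancel] at this

/-- A triangular map of differential modules whose diagonal is homotopic to the identity is a
homotopy equivalence. -/
theorem HtpyEquiv.of_hasDiag [Finite ι] {D : M →ₗ[k] M} {D' : N →ₗ[k] N} {F : M →ₗ[k] N}
    (hD : ∀ x, D (D x) = 0) (hD' : ∀ x, D' (D' x) = 0) (hF : ∀ x, D' (F x) = F (D x))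
    {d f : ∀ p, Q p →ₗ[k] Q p} (hd : HasDiag ρ Φ Φ D d) (hd' : HasDiag ρ Ψ Ψ D' d)
    (hf : HasDiag ρ Φ Ψ F f) (hh : ∀ p, Htpic (d p) (d p) (f p) .id) : HtpyEquiv D D' F := by
  choose h hh using hh
  obtain ⟨H, hH⟩ : ∃ H : M →ₗ[k] N, HasDiag ρ Φ Ψ H h := ⟨_, hasDiag_piMap h⟩
  obtain ⟨I, hI⟩ : ∃ I : N →ₗ[k] M, HasDiag ρ Ψ Φ I fun _ => .id := ⟨_, hasDiag_piMap _⟩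
  -- The correction of `F` by the boundary of `H` is still a chain map homotopic to `F`, but its
  -- diagonal is exactly the identity.
  let T : M →ₗ[k] N := F - D' ∘ₗ H - H ∘ₗ D
  have hT : HasDiag ρ Φ Ψ T fun _ => .id := by
    have := (hf.sub (hd'.comp hH)).sub (hH.comp hd)
    convert this using 2 with p
    ext x
    have := hh p x
    simp only [LinearMap.id_apply] at this
    simp only [LinearMap.id_apply, LinearMap.sub_apply, LinearMap.comp_apply]
    rw [sub_sub, ← this, sub_sub_cancel]
  -- `T` has different source and target; `I` identifies them entrywise, so that both composites are
  -- unipotent endomorphisms.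
  have h₁ : IsUnit (I ∘ₗ T) := HasDiag.isUnit (hI.comp hT)
  have h₂ : IsUnit (T ∘ₗ I) := HasDiag.isUnit (hT.comp hI)
  rw [Module.End.isUnit_iff] at h₁ h₂
  have hb : Function.Bijective T := by
    rw [LinearMap.coe_comp] at h₁ h₂
    exact ⟨h₁.1.of_comp, h₂.2.of_comp⟩
  have hTD (x : M) : D' (T x) = T (D x) := by
    simp only [T, LinearMap.sub_apply, LinearMap.comp_apply, map_sub, hD, hD', hF, map_zero]
    abel
  let e := LinearEquiv.ofBijective T hb
  have he (x : M) : e x = T x := rfl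
  have hFT (x : M) : F x - e x = D' (H x) + H (D x) := by
    simp only [he, T, LinearMap.sub_apply, LinearMap.comp_apply]
    abel
  have hG (y : N) : D (e.symm y) = e.symm (D' y) := by
    rw [LinearEquiv.eq_symm_apply, he, ← hTD, ← he, LinearEquiv.apply_symm_apply]
  refine ⟨e.symm.toLinearMap, hG, ⟨e.symm.toLinearMap ∘ₗ H, fun x => ?_⟩,
    ⟨H ∘ₗ e.symm.toLinearMap, fun y => ?_⟩⟩
  · have := congrArg e.symm (hFT x)
    rw [map_sub, LinearEquiv.symm_apply_apply, map_add, ← hG] at this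
    exact this
  · have := hFT (e.symm y)
    rw [LinearEquiv.apply_symm_apply, hG] at this
    exact this

end Triangular

end Homotopy

/-! ### Differential and multiplication operators on total morphism modules. -/

namespace GradedQuiver

variable {k : Type w} [CommRing k] {Ob : Type u} (Q : GradedQuiver.{u, v} k Ob)

/-- The sign `(-1)^d` in degree `d`. -/
def sgn (X Y : Ob) : Q.Tot X Y →ₗ[k] Q.Tot X Y :=
  DirectSum.toModule k ℤ _ fun d => d.negOnePow • DirectSum.lof k ℤ (Q.Hom X Y) d

variable {Q}

theorem sgn_of {X Y : Ob} {d : ℤ} (x : Q.Hom X Y d) :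
    Q.sgn X Y (DirectSum.of _ d x) = d.negOnePow • DirectSum.of (Q.Hom X Y) d x :=
  DirectSum.toModule_lof k d x

end GradedQuiver

namespace AInftyCategory

open GradedQuiver (sgn_of)

variable {k : Type w} [CommRing k] {Ob : Type u} (A : AInftyCategory.{u, v} k Ob)

/-- The differential `m¹` on the total module. -/
def diff (X Y : Ob) : A.Tot X Y →ₗ[k] A.Tot X Y := slot A.toAInftyData (.nil X) (.nil Y)

variable {A}

/-- The map `m²(a, -)` on the total module. -/
def mulLeft (W : Ob) {X Y : Ob} (a : A.Hom X Y 0) : A.Tot W X →ₗ[k] A.Tot W Y :=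
  slot A.toAInftyData (.nil W) (.cons a (.nil Y))

/-- The map `m²(-, a)` on the total module. -/
def mulRight (W : Ob) {X Y : Ob} (a : A.Hom X Y 0) : A.Tot Y W →ₗ[k] A.Tot X W :=
  slot A.toAInftyData (.cons a (.nil Y)) (.nil W) ∘ₗ A.sgn Y W

theorem bTot_nil (X : Ob) : A.bTot (.nil X) = 0 := by
  rw [AInftyData.bTot, AInftyData.mTot, A.m_nil, map_zero, smul_zero]

theorem bTot_eq {X Y : Ob} (p : A.Chain X Y) (e : ℤ) (h : p.deg + 2 - p.length = e) :
    A.bTot p = p.shiftSign.negOnePow • DirectSum.of (A.Hom X Y) e (A.m p e h) := by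
  rw [AInftyData.bTot, mTot_eq]

theorem diff_of {X Y : Ob} {d : ℤ} (x : A.Hom X Y d) (e : ℤ) (h : d + 1 = e) :
    A.diff X Y (DirectSum.of _ d x) = DirectSum.of (A.Hom X Y) e (A.m₁ x e h) := by
  rw [diff, slot_of]
  refine (bTot_eq _ e ?_).trans ?_
  · simp only [Chain.comp, Chain.deg, Chain.length]; omega
  · simp only [Chain.comp, Chain.shiftSign, Chain.deg, add_zero, Int.negOnePow_zero, one_smul]
    rfl

theorem mulLeft_of (W : Ob) {X Y : Ob} (a : A.Hom X Y 0) {d : ℤ} (x : A.Hom W X d) :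
    mulLeft W a (DirectSum.of _ d x) = DirectSum.of (A.Hom W Y) d (A.m₂ a x d (zero_add d)) := by
  rw [mulLeft, slot_of]
  refine (bTot_eq _ d ?_).trans ?_
  · simp only [Chain.comp, Chain.deg, Chain.length]; omega
  · simp only [Chain.comp, Chain.shiftSign, Chain.deg, add_zero, Int.negOnePow_zero, one_smul]
    rfl

theorem mulRight_of (W : Ob) {X Y : Ob} (a : A.Hom X Y 0) {d : ℤ} (x : A.Hom Y W d) :
    mulRight W a (DirectSum.of _ d x) = DirectSum.of (A.Hom X W) d (A.m₂ x a d (add_zero d)) := by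
  rw [mulRight, LinearMap.comp_apply, sgn_of, map_unit_smul, slot_of]
  refine (congrArg _ (bTot_eq _ d ?_)).trans ?_
  · simp only [Chain.comp, Chain.deg, Chain.length]; omega
  · simp only [Chain.comp, Chain.shiftSign, Chain.deg, add_zero, zero_add, smul_smul,
      Int.units_mul_self, one_smul]
    rfl

theorem mulLeft_of_eq_bTot (W : Ob) {X Y : Ob} (a : A.Hom X Y 0) {d : ℤ} (x : A.Hom W X d) :
    mulLeft W a (DirectSum.of _ d x) = A.bTot (.cons x (.cons a (.nil Y))) :=
  slot_of _ _ _ _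

theorem mulRight_of_eq_bTot (W : Ob) {X Y : Ob} (a : A.Hom X Y 0) {d : ℤ} (x : A.Hom Y W d) :
    mulRight W a (DirectSum.of _ d x) =
      d.negOnePow • A.bTot (.cons a (.cons x (.nil W))) := by
  rw [mulRight, LinearMap.comp_apply, sgn_of, map_unit_smul, slot_of]
  rfl

theorem slot_of_bTot {X Y Z : Ob} {d d' : ℤ} (x : A.Hom X Y d) (y : A.Hom Y Z d') :
    slot A.toAInftyData (.cons x (.nil Y)) (.nil Z) (DirectSum.of _ d' y) =
      A.bTot (.cons x (.cons y (.nil Z))) :=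
  slot_of _ _ _ _

/-- Linear maps on the total module that agree on homogeneous elements are equal. -/
theorem tot_ext {X Y : Ob} {N : Type*} [AddCommGroup N] [Module k N] {F G : A.Tot X Y →ₗ[k] N}
    (h : ∀ (d : ℤ) (x : A.Hom X Y d), F (DirectSum.of _ d x) = G (DirectSum.of _ d x))
    (z : A.Tot X Y) : F z = G z :=
  LinearMap.congr_fun (DirectSum.linearMap_ext k fun d => LinearMap.ext (h d)) z

/-! ### The `A_∞`-relations for one, two and three inputs. -/

/-- In the shifted operations the only sign left is the one for moving `b` past the later entries,
each with its degree lowered by one. -/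
theorem slot_relation {X Y : Ob} (p : A.Chain X Y) :
    (p.splits.map fun s => (s.2.2.splits.map fun t =>
      (t.2.2.deg - t.2.2.length).negOnePow •
        slot A.toAInftyData s.2.1 t.2.2 (A.bTot t.2.1)).sum).sum = 0 := by
  rw [← shiftSign_smul_relationSum, A.relation, smul_zero]

theorem relation_one {X Y : Ob} {d : ℤ} (x : A.Hom X Y d) :
    A.diff X Y (A.bTot (.cons x (.nil Y))) = 0 := by
  simpa [Chain.splits, bTot_nil, Chain.deg, Chain.length, diff] using slot_relation (.cons x (.nil Y))

theorem relation_two {X Y Z : Ob} {d d' : ℤ} (x : A.Hom X Y d) (y : A.Hom Y Z d') :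
    A.diff X Z (A.bTot (.cons x (.cons y (.nil Z)))) +
      slot A.toAInftyData (.cons x (.nil Y)) (.nil Z) (A.bTot (.cons y (.nil Z))) +
      (d' - 1).negOnePow •
        slot A.toAInftyData (.nil X) (.cons y (.nil Z)) (A.bTot (.cons x (.nil Y))) = 0 := by
  have := slot_relation (.cons x (.cons y (.nil Z)))
  simp only [Chain.splits, bTot_nil, Chain.deg, Chain.length, List.map_cons, List.map_nil,
    List.sum_cons, List.sum_nil, map_zero, smul_zero, add_zero, zero_add, sub_self,
    Int.negOnePow_zero, one_smul] at this
  rw [← this, diff]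
  abel

theorem relation_three {X Y Z W : Ob} {d d' d'' : ℤ} (x : A.Hom X Y d) (y : A.Hom Y Z d')
    (z : A.Hom Z W d'') :
    A.diff X W (A.bTot (.cons x (.cons y (.cons z (.nil W))))) +
      slot A.toAInftyData (.cons x (.nil Y)) (.nil W) (A.bTot (.cons y (.cons z (.nil W)))) +
      (d'' - 1).negOnePow • slot A.toAInftyData (.nil X) (.cons z (.nil W))
        (A.bTot (.cons x (.cons y (.nil Z)))) +
      (d' + d'').negOnePow • slot A.toAInftyData (.nil X) (.cons y (.cons z (.nil W)))
        (A.bTot (.cons x (.nil Y))) +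
      (d'' - 1).negOnePow • slot A.toAInftyData (.cons x (.nil Y)) (.cons z (.nil W))
        (A.bTot (.cons y (.nil Z))) +
      slot A.toAInftyData (.cons x (.cons y (.nil Z))) (.nil W) (A.bTot (.cons z (.nil W))) = 0 := by
  have := slot_relation (.cons x (.cons y (.cons z (.nil W))))
  simp only [Chain.splits, bTot_nil, Chain.deg, Chain.length, List.map_cons, List.map_nil,
    List.sum_cons, List.sum_nil, map_zero, smul_zero, add_zero, zero_add, sub_self,
    Int.negOnePow_zero, one_smul] at this
  -- The two later entries contribute `d' + d'' - 2`, which has the parity of `d' + d''`.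
  rw [← this, diff, negOnePow_congr (a := d' + d'') 1 (b := d' + d'' - (1 + 1)) (by ring)]
  abel

theorem bTot_one {X Y : Ob} {d : ℤ} (x : A.Hom X Y d) :
    A.bTot (.cons x (.nil Y)) = A.diff X Y (DirectSum.of _ d x) := by
  rw [diff, slot_of]; rfl

theorem bTot_one_of_isClosed {X Y : Ob} {x : A.Hom X Y 0} (hx : A.IsClosed x) :
    A.bTot (.cons x (.nil Y)) = 0 := by
  rw [bTot_one, diff_of x 1 rfl, hx, map_zero]

theorem diff_diff {X Y : Ob} (z : A.Tot X Y) : A.diff X Y (A.diff X Y z) = 0 :=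
  tot_ext (F := A.diff X Y ∘ₗ A.diff X Y) (G := 0) (fun d x => by
    rw [LinearMap.comp_apply, ← bTot_one, relation_one]; rfl) z

theorem sgn_diff {X Y : Ob} (z : A.Tot X Y) :
    A.sgn X Y (A.diff X Y z) = - A.diff X Y (A.sgn X Y z) :=
  tot_ext (F := A.sgn X Y ∘ₗ A.diff X Y) (G := - A.diff X Y ∘ₗ A.sgn X Y) (fun d x => by
    simp only [LinearMap.comp_apply, sgn_of, map_unit_smul, LinearMap.neg_apply,
      diff_of x _ rfl, Int.negOnePow_succ, Units.neg_smul]) z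

/-! ### Multiplication by closed morphisms up to homotopy. -/

theorem diff_mulLeft (W : Ob) {X Y : Ob} {a : A.Hom X Y 0} (ha : A.IsClosed a) (z : A.Tot W X) :
    A.diff W Y (mulLeft W a z) = mulLeft W a (A.diff W X z) :=
  tot_ext (F := A.diff W Y ∘ₗ mulLeft W a) (G := mulLeft W a ∘ₗ A.diff W X) (fun d x => by
    have := relation_two x a
    rw [bTot_one_of_isClosed ha, map_zero, add_zero, zero_sub, Int.negOnePow_neg,
      Int.negOnePow_one, Units.neg_smul, one_smul, add_neg_eq_zero, bTot_one] at this
    rw [LinearMap.comp_apply, LinearMap.comp_apply, mulLeft, slot_of]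
    exact this) z

/-- The shifted right multiplication anticommutes with the differential. Since `sgn` does too, their
composite `mulRight` is a chain map. -/
theorem diff_slot_cons_nil (W : Ob) {X Y : Ob} {a : A.Hom X Y 0} (ha : A.IsClosed a)
    (z : A.Tot Y W) :
    A.diff X W (slot A.toAInftyData (.cons a (.nil Y)) (.nil W) z) =
      - slot A.toAInftyData (.cons a (.nil Y)) (.nil W) (A.diff Y W z) :=
  tot_ext (F := A.diff X W ∘ₗ slot A.toAInftyData (.cons a (.nil Y)) (.nil W))
    (G := - slot A.toAInftyData (.cons a (.nil Y)) (.nil W) ∘ₗ A.diff Y W) (fun d x => by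
    have := relation_two a x
    rw [bTot_one_of_isClosed ha, map_zero, smul_zero, add_zero, add_eq_zero_iff_eq_neg,
      bTot_one] at this
    rw [LinearMap.comp_apply, LinearMap.neg_apply, LinearMap.comp_apply, slot_of]
    exact this) z

theorem diff_mulRight (W : Ob) {X Y : Ob} {a : A.Hom X Y 0} (ha : A.IsClosed a) (z : A.Tot Y W) :
    A.diff X W (mulRight W a z) = mulRight W a (A.diff Y W z) := by
  simp only [mulRight, LinearMap.comp_apply, diff_slot_cons_nil W ha, sgn_diff, map_neg]

theorem m₂_closed {X Y Z : Ob} {c : A.Hom X Y 0} {a : A.Hom Y Z 0} (hc : A.IsClosed c)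
    (ha : A.IsClosed a) : A.IsClosed (A.m₂ a c 0 rfl) := by
  have := diff_mulLeft X ha (DirectSum.of _ 0 c)
  rw [mulLeft_of, diff_of c 1 rfl, hc, map_zero, map_zero, diff_of _ 1 rfl] at this
  exact DirectSum.of_injective (β := A.Hom X Z) 1 (this.trans (map_zero _).symm)

/-- `m²(a, m²(c, -))` is homotopic to `m²(m²(a, c), -)`. -/
theorem htpic_mulLeft_m₂ (W : Ob) {X Y Z : Ob} {c : A.Hom X Y 0} {a : A.Hom Y Z 0}
    (hc : A.IsClosed c) (ha : A.IsClosed a) :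
    Htpic (A.diff W X) (A.diff W Z) (mulLeft W a ∘ₗ mulLeft W c) (mulLeft W (A.m₂ a c 0 rfl)) := by
  -- The homotopy is `m³(a, c, -)`. In the relation for three inputs the terms with `m¹(a)` and
  -- `m¹(c)` vanish.
  refine ⟨slot A.toAInftyData (.nil W) (.cons c (.cons a (.nil Z))), fun z => ?_⟩
  refine tot_ext (F := mulLeft W a ∘ₗ mulLeft W c - mulLeft W (A.m₂ a c 0 rfl))
    (G := A.diff W Z ∘ₗ slot A.toAInftyData (.nil W) (.cons c (.cons a (.nil Z))) +
      slot A.toAInftyData (.nil W) (.cons c (.cons a (.nil Z))) ∘ₗ A.diff W X) (fun d x => ?_) z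
  have h := relation_three x c a
  have hca : A.bTot (.cons c (.cons a (.nil Z))) = DirectSum.of (A.Hom X Z) 0 (A.m₂ a c 0 rfl) := by
    rw [← mulLeft_of, mulLeft, slot_of]; rfl
  rw [bTot_one_of_isClosed ha, bTot_one_of_isClosed hc, hca, slot_of, bTot_one] at h
  simp only [map_zero, smul_zero, add_zero, zero_sub, Int.negOnePow_neg, Int.negOnePow_one,
    Units.neg_smul, one_smul, Int.negOnePow_zero] at h
  simp only [LinearMap.sub_apply, LinearMap.add_apply, LinearMap.comp_apply]
  rw [mulLeft, mulLeft, mulLeft, slot_of, slot_of, slot_of]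
  simp only [Chain.comp] at h ⊢
  rw [← sub_eq_zero, ← neg_eq_zero, ← h]
  abel

/-- `m²(m²(-, a), c)` is homotopic to `m²(-, m²(a, c))`. -/
theorem htpic_mulRight_m₂ (W : Ob) {X Y Z : Ob} {c : A.Hom X Y 0} {a : A.Hom Y Z 0}
    (hc : A.IsClosed c) (ha : A.IsClosed a) :
    Htpic (A.diff Z W) (A.diff X W) (mulRight W c ∘ₗ mulRight W a)
      (mulRight W (A.m₂ a c 0 rfl)) := by
  -- Here the homotopy is `-m³(-, a, c)`: the iterated product enters the three-term relation with
  -- the sign opposite to the one it has for left multiplication.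
  refine ⟨-slot A.toAInftyData (.cons c (.cons a (.nil Z))) (.nil W), fun z => ?_⟩
  refine tot_ext (F := mulRight W c ∘ₗ mulRight W a - mulRight W (A.m₂ a c 0 rfl))
    (G := A.diff X W ∘ₗ (-slot A.toAInftyData (.cons c (.cons a (.nil Z))) (.nil W)) +
      (-slot A.toAInftyData (.cons c (.cons a (.nil Z))) (.nil W)) ∘ₗ A.diff Z W)
    (fun d x => ?_) z
  have h := relation_three c a x
  have hca : A.bTot (.cons c (.cons a (.nil Z))) = DirectSum.of (A.Hom X Z) 0 (A.m₂ a c 0 rfl) := by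
    rw [← mulLeft_of, mulLeft, slot_of]; rfl
  rw [bTot_one_of_isClosed ha, bTot_one_of_isClosed hc, hca, slot_of, bTot_one] at h
  simp only [map_zero, smul_zero, add_zero, Int.negOnePow_sub, Int.negOnePow_one, mul_neg, mul_one,
    Units.neg_smul] at h
  simp only [LinearMap.sub_apply, LinearMap.add_apply, LinearMap.comp_apply, LinearMap.neg_apply]
  -- Both multiplications preserve the degree `d` of `x`, so the two signs `(-1)^d` cancel.
  have hax : slot A.toAInftyData (.cons c (.nil Y)) (.nil W) (A.bTot (.cons a (.cons x (.nil W)))) =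
      mulRight W c (mulRight W a (DirectSum.of _ d x)) := by
    rw [mulRight_of, mulRight_of_eq_bTot, ← slot_of_bTot c (A.m₂ x a d (add_zero d)),
      ← mulRight_of W a x,
      mulRight_of_eq_bTot, map_unit_smul, smul_smul, Int.units_mul_self, one_smul]
  rw [hax] at h
  rw [mulRight_of_eq_bTot W (A.m₂ a c 0 rfl) x, slot_of]
  simp only [Chain.comp] at h ⊢
  rw [← sub_eq_zero, ← h, map_neg]
  abel

/-- Cohomologous morphisms act on the left by homotopic maps. -/
theorem htpic_mulLeft {X Y : Ob} (W : Ob) {a a' : A.Hom X Y 0} (h : A.Cohomologous a a') :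
    Htpic (A.diff W X) (A.diff W Y) (mulLeft W a) (mulLeft W a') := by
  obtain ⟨h, hh⟩ := h
  -- The minus sign undoes the shift sign of `h`, which has degree `-1`; the homotopy is `m²(h, -)`.
  refine ⟨-slot A.toAInftyData (.nil W) (.cons h (.nil Y)), fun z => ?_⟩
  refine tot_ext (F := mulLeft W a - mulLeft W a')
    (G := A.diff W Y ∘ₗ (-slot A.toAInftyData (.nil W) (.cons h (.nil Y))) +
      (-slot A.toAInftyData (.nil W) (.cons h (.nil Y))) ∘ₗ A.diff W X) (fun d x => ?_) z
  have h₂ := relation_two x h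
  have h₁ : slot A.toAInftyData (.cons x (.nil X)) (.nil Y) (A.bTot (.cons h (.nil Y))) =
      mulLeft W a (DirectSum.of _ d x) - mulLeft W a' (DirectSum.of _ d x) := by
    rw [bTot_one, diff_of h 0 rfl, ← hh, map_sub, map_sub, slot_of_bTot, slot_of_bTot,
      mulLeft_of_eq_bTot, mulLeft_of_eq_bTot]
  rw [h₁, bTot_one, negOnePow_congr (b := 0) (-1) (by norm_num), Int.negOnePow_zero,
    one_smul] at h₂
  simp only [LinearMap.sub_apply, LinearMap.add_apply, LinearMap.comp_apply, LinearMap.neg_apply]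
  rw [slot_of]
  simp only [Chain.comp]
  rw [← sub_eq_zero, ← h₂, map_neg]
  abel

/-- Cohomologous morphisms act on the right by homotopic maps. -/
theorem htpic_mulRight {X Y : Ob} (W : Ob) {a a' : A.Hom X Y 0} (h : A.Cohomologous a a') :
    Htpic (A.diff Y W) (A.diff X W) (mulRight W a) (mulRight W a') := by
  obtain ⟨h, hh⟩ := h
  refine ⟨slot A.toAInftyData (.cons h (.nil Y)) (.nil W), fun z => ?_⟩
  refine tot_ext (F := mulRight W a - mulRight W a')
    (G := A.diff X W ∘ₗ slot A.toAInftyData (.cons h (.nil Y)) (.nil W) +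
      slot A.toAInftyData (.cons h (.nil Y)) (.nil W) ∘ₗ A.diff Y W) (fun d x => ?_) z
  have h₂ := relation_two h x
  have h₁ : (d - 1).negOnePow •
      slot A.toAInftyData (.nil X) (.cons x (.nil W)) (A.bTot (.cons h (.nil Y))) =
      - (mulRight W a (DirectSum.of _ d x) - mulRight W a' (DirectSum.of _ d x)) := by
    rw [bTot_one, diff_of h 0 rfl, ← hh, map_sub, map_sub, slot_of, slot_of,
      mulRight_of_eq_bTot, mulRight_of_eq_bTot, ← smul_sub, Int.negOnePow_sub, Int.negOnePow_one,
      mul_neg, mul_one, Units.neg_smul]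
    rfl
  rw [h₁, bTot_one] at h₂
  simp only [LinearMap.sub_apply, LinearMap.add_apply, LinearMap.comp_apply]
  rw [slot_of_bTot, ← sub_eq_zero, ← neg_eq_zero, ← h₂]
  abel

/-! ### Passing between total modules and single degrees. -/

theorem diff_apply {X Y : Ob} (z : A.Tot X Y) (d e : ℤ) (h : d + 1 = e) :
    A.diff X Y z e = A.m₁ (z d) e h := by
  have h₀ : A.m₁ (0 : A.Hom X Y d) e h = 0 := by
    have := diff_of (0 : A.Hom X Y d) e h
    rw [map_zero, map_zero] at this
    exact DirectSum.of_injective (β := A.Hom X Y) e (this.symm.trans (map_zero _).symm)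
  have h_add (x y : A.Hom X Y d) : A.m₁ (x + y) e h = A.m₁ x e h + A.m₁ y e h := by
    refine DirectSum.of_injective (β := A.Hom X Y) e ?_
    rw [map_add, ← diff_of, ← diff_of, ← diff_of, map_add, map_add]
  induction z using DirectSum.induction_on with
  | zero => rw [map_zero]; exact h₀.symm
  | of d' x =>
    rw [diff_of x _ rfl]
    by_cases hd : d' = d
    · subst hd; subst h
      rw [DirectSum.of_eq_same, DirectSum.of_eq_same]
    · rw [DirectSum.of_eq_of_ne _ _ _ (by omega), DirectSum.of_eq_of_ne _ _ _ (Ne.symm hd), h₀]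
  | add x y hx hy => rw [map_add, DirectSum.add_apply, DirectSum.add_apply, hx, hy, h_add]

theorem isClosed_iff {X Y : Ob} (x : A.Hom X Y 0) :
    A.IsClosed x ↔ A.diff X Y (DirectSum.of _ 0 x) = 0 := by
  rw [diff_of x 1 rfl]
  exact ⟨fun h => by rw [h, map_zero], fun h =>
    DirectSum.of_injective (β := A.Hom X Y) 1 (h.trans (map_zero _).symm)⟩

theorem cohomologous_iff {X Y : Ob} (x y : A.Hom X Y 0) :
    A.Cohomologous x y ↔
      ∃ z, DirectSum.of (A.Hom X Y) 0 x - DirectSum.of _ 0 y = A.diff X Y z := by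
  constructor
  · rintro ⟨h, hh⟩
    exact ⟨DirectSum.of _ _ h, by rw [diff_of h 0 rfl, ← hh, map_sub]⟩
  · rintro ⟨z, hz⟩
    refine ⟨z (-1), ?_⟩
    rw [← diff_apply, ← hz, ← map_sub, DirectSum.of_eq_same]

theorem htpic_of_homotopicToId {X Y : Ob} {F : ∀ d, A.Hom X Y d → A.Hom X Y d}
    (h : A.HomotopicToId F) (L : A.Tot X Y →ₗ[k] A.Tot X Y)
    (hL : ∀ (d : ℤ) (x : A.Hom X Y d), L (DirectSum.of _ d x) = DirectSum.of _ d (F d x)) :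
    Htpic (A.diff X Y) (A.diff X Y) L .id := by
  obtain ⟨H, hH⟩ := h
  let H' : A.Tot X Y →ₗ[k] A.Tot X Y := DirectSum.toModule k ℤ _ fun d =>
    DirectSum.lof k ℤ (A.Hom X Y) (d - 1) ∘ₗ H d (d - 1) (by omega)
  have hH' (d d' : ℤ) (h : d' + 1 = d) (x : A.Hom X Y d) :
      H' (DirectSum.of _ d x) = DirectSum.of (A.Hom X Y) d' (H d d' h x) := by
    obtain rfl : d' = d - 1 := by omega
    exact DirectSum.toModule_lof k d x
  refine ⟨H', fun z => ?_⟩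
  refine tot_ext (F := L - .id) (G := A.diff X Y ∘ₗ H' + H' ∘ₗ A.diff X Y) (fun d x => ?_) z
  simp only [LinearMap.sub_apply, LinearMap.add_apply, LinearMap.comp_apply, LinearMap.id_apply]
  rw [hL, ← map_sub, hH, hH' d (d - 1) (by omega), diff_of x _ rfl, hH' (d + 1) d rfl,
    diff_of _ d (by omega), map_add]

theorem homotopicToId_of_htpic {X Y : Ob} {F : ∀ d, A.Hom X Y d → A.Hom X Y d}
    (L : A.Tot X Y →ₗ[k] A.Tot X Y)
    (hL : ∀ (d : ℤ) (x : A.Hom X Y d), L (DirectSum.of _ d x) = DirectSum.of _ d (F d x))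
    (h : Htpic (A.diff X Y) (A.diff X Y) L .id) : A.HomotopicToId F := by
  obtain ⟨H, hH⟩ := h
  -- `H` need not be homogeneous. As `L` preserves degrees and the differential raises them by one,
  -- the part of `H` lowering degrees by one is already a homotopy.
  refine ⟨fun d d' _ => DirectSum.component k ℤ (A.Hom X Y) d' ∘ₗ H ∘ₗ
    DirectSum.lof k ℤ (A.Hom X Y) d, fun d x => ?_⟩
  have := congrArg (fun z : A.Tot X Y => z d) (hH (DirectSum.of _ d x))
  simp only [hL, LinearMap.id_apply, ← map_sub, DirectSum.of_eq_same, DirectSum.add_apply] at this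
  rw [this, diff_apply _ (d - 1) d (by omega), diff_of x (d + 1) rfl]
  rfl

theorem apply_of_homogeneous {X Y X' Y' : Ob} {F : A.Tot X Y →ₗ[k] A.Tot X' Y'}
    {f : ∀ d, A.Hom X Y d → A.Hom X' Y' d}
    (hF : ∀ (d : ℤ) (x : A.Hom X Y d), F (DirectSum.of _ d x) = DirectSum.of _ d (f d x))
    (z : A.Tot X Y) (d : ℤ) : F z d = f d (z d) := by
  have h_eq (x : A.Hom X Y d) : f d x = F (DirectSum.of _ d x) d := by
    rw [hF, DirectSum.of_eq_same]
  rw [h_eq]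
  induction z using DirectSum.induction_on with
  | zero => simp
  | of d' x =>
    by_cases hd : d' = d
    · subst hd
      rw [DirectSum.of_eq_same]
    · rw [DirectSum.of_eq_of_ne _ _ _ (Ne.symm hd), hF, DirectSum.of_eq_of_ne _ _ _ (Ne.symm hd)]
      simp
  | add x y hx hy => simp only [map_add, DirectSum.add_apply, hx, hy]

/-- A homogeneous homotopy equivalence is surjective on cohomology. -/
theorem exists_cohomologous {X Y X' Y' : Ob} {F : A.Tot X Y →ₗ[k] A.Tot X' Y'}
    (h : HtpyEquiv (A.diff X Y) (A.diff X' Y') F) {f : ∀ d, A.Hom X Y d → A.Hom X' Y' d}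
    (hF : ∀ (d : ℤ) (x : A.Hom X Y d), F (DirectSum.of _ d x) = DirectSum.of _ d (f d x))
    {y : A.Hom X' Y' 0} (hy : A.IsClosed y) :
    ∃ x : A.Hom X Y 0, A.IsClosed x ∧ A.Cohomologous (f 0 x) y := by
  obtain ⟨G, hG, -, H, hH⟩ := h
  rw [isClosed_iff] at hy
  -- `G` need not preserve degrees either; the degree `0` part of `G y` is still closed, and the
  -- degree `-1` part of `H y` bounds the difference.
  refine ⟨G (DirectSum.of _ 0 y) 0, ?_, H (DirectSum.of _ 0 y) (-1), ?_⟩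
  · rw [IsClosed, ← diff_apply, hG, hy, map_zero]
    rfl
  · have := congrArg (fun z : A.Tot X' Y' => z 0) (hH (DirectSum.of _ 0 y))
    simp only [hy, map_zero, add_zero, LinearMap.comp_apply, LinearMap.id_apply] at this
    rw [← diff_apply, ← this, DirectSum.sub_apply, DirectSum.of_eq_same, apply_of_homogeneous hF]

/-- A homotopy equivalence is injective on cohomology. -/
theorem cohomologous_of_apply {X Y X' Y' : Ob} {F : A.Tot X Y →ₗ[k] A.Tot X' Y'}
    (h : HtpyEquiv (A.diff X Y) (A.diff X' Y') F) {x y : A.Hom X Y 0} (hx : A.IsClosed x)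
    (hy : A.IsClosed y)
    (hxy : ∃ z, F (DirectSum.of _ 0 x) - F (DirectSum.of _ 0 y) = A.diff X' Y' z) :
    A.Cohomologous x y := by
  obtain ⟨G, hG, ⟨H, hH⟩, -⟩ := h
  obtain ⟨z, hz⟩ := hxy
  rw [isClosed_iff] at hx hy
  rw [cohomologous_iff]
  have h₁ := hH (DirectSum.of _ 0 x - DirectSum.of _ 0 y)
  rw [map_sub (A.diff X Y), hx, hy, sub_zero, map_zero, add_zero, LinearMap.comp_apply, map_sub F,
    hz, ← hG, LinearMap.id_apply, sub_eq_iff_eq_add] at h₁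
  -- For `w = x - y` and `F w = D z`, the homotopy from `G F` to the identity gives `D (G z) - w = D
  -- (H w)`.
  refine ⟨G z - H (DirectSum.of _ 0 x - DirectSum.of _ 0 y), ?_⟩
  rw [map_sub, h₁]
  abel

/-! ### A criterion for isomorphisms in `H⁰`. -/

theorem IsUnit.of_htpic {X : Ob} {e : A.Hom X X 0} (he : A.IsClosed e)
    (hl : ∀ W, Htpic (A.diff W X) (A.diff W X) (mulLeft W e) .id)
    (hr : ∀ W, Htpic (A.diff X W) (A.diff X W) (mulRight W e) .id) : A.IsUnit e :=
  ⟨he, fun W => homotopicToId_of_htpic _ (fun _ x => mulLeft_of W e x) (hl W),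
    fun W => homotopicToId_of_htpic _ (fun _ x => mulRight_of W e x) (hr W)⟩

/-- A closed morphism that acts by homotopy equivalences on both sides is an isomorphism in `H⁰`;
in particular, its source and its target have units. -/
theorem isomorphicInH0_of_htpyEquiv {X Y : Ob} {a : A.Hom X Y 0} (ha : A.IsClosed a)
    (hl : ∀ W, HtpyEquiv (A.diff W X) (A.diff W Y) (mulLeft W a))
    (hr : ∀ W, HtpyEquiv (A.diff Y W) (A.diff X W) (mulRight W a)) : A.IsomorphicInH0 X Y := by
  -- Surjectivity on cohomology solves `a e ≃ a`, `e' a ≃ a` and `a b ≃ e'` in turn.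
  obtain ⟨e, he, hae⟩ := exists_cohomologous (hl X) (fun _ x => mulLeft_of X a x) ha
  obtain ⟨e', he', hea⟩ := exists_cohomologous (hr Y) (fun _ x => mulRight_of Y a x) ha
  obtain ⟨b, hb, hab⟩ := exists_cohomologous (hl Y) (fun _ x => mulLeft_of Y a x) he'
  -- Multiplying by `e` and then by `a` is homotopic to multiplying by `a e`, hence by `a`; now `a`
  -- is cancelled. The same argument applies on the right, and to `e'`.
  have hu : A.IsUnit e := .of_htpic he
    (fun W => (hl W).cancel_left (fun z => diff_mulLeft W he z)
      ((htpic_mulLeft_m₂ W he ha).trans (htpic_mulLeft W hae)))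
    (fun W => (hr W).cancel_right (fun z => diff_mulRight W he z)
      ((htpic_mulRight_m₂ W he ha).trans (htpic_mulRight W hae)))
  have hu' : A.IsUnit e' := .of_htpic he'
    (fun W => (hl W).cancel_right (fun z => diff_mulLeft W he' z)
      ((htpic_mulLeft_m₂ W ha he').trans (htpic_mulLeft W hea)))
    (fun W => (hr W).cancel_left (fun z => diff_mulRight W he' z)
      ((htpic_mulRight_m₂ W ha he').trans (htpic_mulRight W hea)))
  refine ⟨a, b, ha, hb, ⟨e, hu, ?_⟩, ⟨e', hu', hab⟩⟩
  -- After multiplication by `a`, which is injective on cohomology: `a (b a) ≃ (a b) a ≃ e' a ≃ a ≃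
  -- a e`.
  refine cohomologous_of_apply (hl X) (m₂_closed ha hb) he ?_
  have haz := (isClosed_iff a).1 ha
  obtain ⟨H₁, h₁⟩ := htpic_mulLeft_m₂ X hb ha
  obtain ⟨H₂, h₂⟩ := htpic_mulLeft X hab
  replace h₁ := h₁ (DirectSum.of _ 0 a)
  replace h₂ := h₂ (DirectSum.of _ 0 a)
  obtain ⟨z₃, h₃⟩ := (cohomologous_iff _ _).1 hea
  obtain ⟨z₄, h₄⟩ := (cohomologous_iff _ _).1 hae
  simp only [haz, map_zero, add_zero] at h₁ h₂
  rw [LinearMap.comp_apply, mulLeft_of X b a] at h₁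
  rw [mulLeft_of X e' a] at h₂
  rw [← mulLeft_of X a e] at h₄
  refine ⟨H₁ (DirectSum.of _ 0 a) + H₂ (DirectSum.of _ 0 a) + z₃ - z₄, ?_⟩
  rw [map_sub, map_add, map_add, ← h₁, ← h₂, ← h₃, ← h₄]
  abel

end AInftyCategory

/-! ### Matrix entries of morphisms of twisted complexes. -/

namespace AInftyCategory

open GradedQuiver (sgn_of)

variable {k : Type w} [CommRing k] {Ob : Type u} {A : AInftyCategory.{u, v} k Ob}

/-- All matrix components of an element of the total morphism module of twisted complexes. -/
def entryHom (T S : A.TwistedComplex) :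
    A.twQuiver.Tot T S →ₗ[k] ∀ p : Fin T.r × Fin S.r, A.Tot (T.obj p.1) (S.obj p.2) where
  toFun := fun z (p : Fin T.r × Fin S.r) => entry p.1 p.2 z
  map_add' x y := funext fun p => map_add (entry p.1 p.2) x y
  map_smul' c x := by
    funext p
    induction x using DirectSum.induction_on with
    | zero => simp
    | of d x =>
      have h : c • DirectSum.of (A.twQuiver.Hom T S) d x = DirectSum.of _ d (c • x) :=
        ((DirectSum.lof k ℤ (A.twQuiver.Hom T S) d).map_smul c x).symm
      rw [h, entry_of, RingHom.id_apply, Pi.smul_apply, entry_of]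
      exact (DirectSum.lof k ℤ (A.Hom (T.obj p.1) (S.obj p.2)) _).map_smul c _
    | add x y hx hy =>
      simp only [RingHom.id_apply, Pi.smul_apply] at hx hy ⊢
      rw [smul_add, map_add, map_add, smul_add, hx, hy]

theorem entryHom_bijective (T S : A.TwistedComplex) : Function.Bijective (entryHom T S) := by
  constructor
  · intro x y h
    refine DFinsupp.ext fun d => ?_
    funext i j
    have h' : entry i j x = entry i j y := congrFun h (i, j)
    have := congrArg (fun z : A.Tot (T.obj i) (S.obj j) => z (d + S.shift j - T.shift i)) h'
    exact (entry_apply i j x d).symm.trans (this.trans (entry_apply i j y d))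
  · have key (p : Fin T.r × Fin S.r) (y : A.Tot (T.obj p.1) (S.obj p.2)) :
        ∃ z, entryHom T S z = Pi.single p y := by
      induction y using DirectSum.induction_on with
      | zero => exact ⟨0, by rw [map_zero, Pi.single_zero]⟩
      | of e x =>
        -- For a fixed entry the passage to matrix degree is a translation of `ℤ`, so every degree
        -- of the entry is reached.
        obtain ⟨d, rfl⟩ : ∃ d, e = d + S.shift p.2 - T.shift p.1 :=
          ⟨e - S.shift p.2 + T.shift p.1, by ring⟩
        let z : A.twQuiver.Hom T S d := fun i j =>
          (Pi.single p x : ∀ q : Fin T.r × Fin S.r,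
            A.Hom (T.obj q.1) (S.obj q.2) (d + S.shift q.2 - T.shift q.1)) (i, j)
        refine ⟨DirectSum.of _ d z, funext fun q => (entry_of q.1 q.2 z).trans ?_⟩
        by_cases hq : q = p
        · subst hq
          simp only [z, Pi.single_eq_same]
        · simp only [z, Pi.single_eq_of_ne hq, map_zero]
      | add x y hx hy =>
        obtain ⟨z, hz⟩ := hx
        obtain ⟨z', hz'⟩ := hy
        exact ⟨z + z', by rw [map_add, hz, hz', Pi.single_add]⟩
    intro y
    choose z hz using key
    exact ⟨∑ p, z p (y p), by rw [map_sum]; simp only [hz, Finset.univ_sum_single]⟩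

/-- The decomposition of the total morphism module of twisted complexes into matrix components. -/
noncomputable def entryEquiv (T S : A.TwistedComplex) :
    A.twQuiver.Tot T S ≃ₗ[k] ∀ p : Fin T.r × Fin S.r, A.Tot (T.obj p.1) (S.obj p.2) :=
  LinearEquiv.ofBijective (entryHom T S) (entryHom_bijective T S)

theorem bTot_comp_zero {W X Y Z : Ob} (p : A.Chain W X) (d : ℤ) (q : A.Chain Y Z) :
    A.bTot (p.comp (.cons (0 : A.Hom X Y d) q)) = 0 := by
  have := bTot_smul A.toAInftyData p (0 : k) (0 : A.Hom X Y d) q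
  rwa [zero_smul, zero_smul] at this

theorem slot_right_zero {W X Y Z Z' V : Ob} (p : A.Chain W X) (q : A.Chain Y Z) (d : ℤ)
    (q' : A.Chain Z' V) (x : A.Tot X Y) :
    slot A.toAInftyData p (q.comp (.cons (0 : A.Hom Z Z' d) q')) x = 0 :=
  tot_ext (G := 0) (fun d' x => by
    rw [slot_of]
    have := bTot_comp_zero (p.comp (.cons x q)) d q'
    rw [chain_comp_assoc] at this
    exact this) x

theorem slot_left_zero {W X Y Z Z' V : Ob} (p : A.Chain W X) (d : ℤ) (p' : A.Chain Y Z)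
    (q : A.Chain Z' V) (x : A.Tot Z Z') :
    slot A.toAInftyData (p.comp (.cons (0 : A.Hom X Y d) p')) q x = 0 :=
  tot_ext (G := 0) (fun d x => by
    rw [slot_of, chain_comp_assoc]
    exact bTot_comp_zero p _ (p'.comp (.cons x q))) x

/-- Additivity extends the word formula from homogeneous `z` to all of the total module, which is
what `HasDiag` quantifies over. -/
theorem entry_slot_apply {T U V S : A.TwistedComplex} (i : Fin T.r) (j : Fin S.r)
    (p : A.twQuiver.Chain T U) (q : A.twQuiver.Chain V S) (z : A.twQuiver.Tot U V) :
    entry i j (slot A.twData p q z) = (S.shift j).negOnePow •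
      ((List.finRange U.r).map fun a => ((twWords p i a).map fun w =>
        ((List.finRange V.r).map fun b => ((twWords q b j).map fun v =>
          slot A.toAInftyData w v (entry a b z)).sum).sum).sum).sum := by
  induction z using DirectSum.induction_on with
  | zero => simp
  | of d z =>
    refine (congrArg _ (slot_of A.twData p q z)).trans ?_
    rw [entry_bTot, twSum_comp_cons]
    simp only [entry_of]
  | add x y hx hy =>
    simp only [map_add, List.sum_map_add, smul_add] at hx hy ⊢
    rw [hx, hy]

theorem entry_sgn {T S : A.TwistedComplex} (i : Fin T.r) (j : Fin S.r) (z : A.twQuiver.Tot T S) :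
    entry i j (A.twQuiver.sgn T S z) =
      (S.shift j - T.shift i).negOnePow • A.sgn (T.obj i) (S.obj j) (entry i j z) := by
  induction z using DirectSum.induction_on with
  | zero => simp
  | of d z =>
    rw [sgn_of, map_unit_smul, entry_of, sgn_of, smul_smul, ← Int.negOnePow_add]
    congr 1
    exact negOnePow_congr (T.shift i - S.shift j) (by ring)
  | add x y hx hy => simp only [map_add, smul_add, hx, hy]

/-! ### Sums over words in `δ` and over words of a morphism of cones. -/

section sums

/-- Every component of `δ` in a word strictly raises the index. -/
theorem dWords_of_lt (T : A.PreTwisted) (i j : Fin T.r) (h : j < i) : T.dWords i j = [] := by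
  rw [PreTwisted.dWords, dif_neg h.ne', List.nil_append, List.flatMap_eq_nil_iff]
  intro a _
  split
  · next ha => rw [dWords_of_lt T a j (h.trans ha), List.map_nil]
  · rfl
termination_by T.r - i.1

theorem dWords_self (T : A.PreTwisted) (i : Fin T.r) : T.dWords i i = [.nil (T.obj i)] := by
  refine (PreTwisted.dWords.eq_1 T i i).trans ?_
  rw [dif_pos rfl]
  refine List.append_right_eq_self.2 (List.flatMap_eq_nil_iff.2 ?_)
  intro a _
  split
  · next ha => rw [dWords_of_lt T a i ha, List.map_nil]
  · rfl

variable {M : Type*} [AddCommMonoid M]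

/-- Words from `i` only reach indices `a ≥ i`, and those with `a > i` are discarded by hypothesis,
so only the empty word survives. This isolates diagonal terms. -/
theorem sum_dWords_source (T : A.PreTwisted) (i : Fin T.r)
    (φ : ∀ a, A.Chain (T.obj i) (T.obj a) → M) (h : ∀ a w, i < a → φ a w = 0) :
    ((List.finRange T.r).map fun a => ((T.dWords i a).map (φ a)).sum).sum = φ i (.nil _) := by
  rw [← Fin.sum_univ_def, Finset.sum_eq_single i]
  · rw [dWords_self, List.map_singleton, List.sum_singleton]
  · intro a _ ha
    rcases lt_or_gt_of_ne ha with ha | ha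
    · rw [dWords_of_lt T i a ha, List.map_nil, List.sum_nil]
    · exact List.sum_eq_zero fun x hx => by
        obtain ⟨w, -, rfl⟩ := List.mem_map.1 hx
        exact h a w ha
  · simp

theorem sum_dWords_target (T : A.PreTwisted) (j : Fin T.r)
    (φ : ∀ b, A.Chain (T.obj b) (T.obj j) → M) (h : ∀ b v, b < j → φ b v = 0) :
    ((List.finRange T.r).map fun b => ((T.dWords b j).map (φ b)).sum).sum = φ j (.nil _) := by
  rw [← Fin.sum_univ_def, Finset.sum_eq_single j]
  · rw [dWords_self, List.map_singleton, List.sum_singleton]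
  · intro b _ hb
    rcases lt_or_gt_of_ne hb with hb | hb
    · exact List.sum_eq_zero fun x hx => by
        obtain ⟨v, -, rfl⟩ := List.mem_map.1 hx
        exact h b v hb
    · rw [dWords_of_lt T b j hb, List.map_nil, List.sum_nil]
  · simp

theorem sum_finRange_two (F : Fin 2 → M) : ((List.finRange 2).map F).sum = F 0 + F 1 := by
  rw [← Fin.sum_univ_def, Fin.sum_univ_two]

variable {X Y : Ob} (f : A.Hom X Y 0) {g : A.Hom X Y 0} {hf : A.IsClosed f} {hg : A.IsClosed g}

theorem sum_dWords_preCone_zero_source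
    (φ : ∀ a : Fin 2, A.Chain X ((preCone f).obj a) → M) :
    ((List.finRange 2).map fun a => (((preCone f).dWords (0 : Fin 2) a).map (φ a)).sum).sum =
      φ 0 (.nil X) + φ 1 (.cons f (.nil Y)) := by
  obtain ⟨h₀, h₁, -, -⟩ := dWords_preCone f
  refine (sum_finRange_two _).trans (congrArg₂ (· + ·) ((congrArg (fun l => (l.map (φ 0)).sum) h₀).trans ?_)
    ((congrArg (fun l => (l.map (φ 1)).sum) h₁).trans ?_))
  · exact List.sum_singleton
  · exact List.sum_singleton

theorem sum_dWords_preCone_one_source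
    (φ : ∀ a : Fin 2, A.Chain Y ((preCone f).obj a) → M) :
    ((List.finRange 2).map fun a => (((preCone f).dWords (1 : Fin 2) a).map (φ a)).sum).sum =
      φ 1 (.nil Y) := by
  obtain ⟨-, -, h₀, h₁⟩ := dWords_preCone f
  refine (sum_finRange_two _).trans ((congrArg₂ (· + ·) ((congrArg (fun l => (l.map (φ 0)).sum) h₀).trans ?_)
    ((congrArg (fun l => (l.map (φ 1)).sum) h₁).trans ?_)).trans (zero_add _))
  · exact List.sum_nil
  · exact List.sum_singleton

theorem sum_dWords_preCone_zero_target
    (φ : ∀ b : Fin 2, A.Chain ((preCone f).obj b) X → M) :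
    ((List.finRange 2).map fun b => (((preCone f).dWords b (0 : Fin 2)).map (φ b)).sum).sum =
      φ 0 (.nil X) := by
  obtain ⟨h₀, -, h₁, -⟩ := dWords_preCone f
  refine (sum_finRange_two _).trans ((congrArg₂ (· + ·) ((congrArg (fun l => (l.map (φ 0)).sum) h₀).trans ?_)
    ((congrArg (fun l => (l.map (φ 1)).sum) h₁).trans ?_)).trans (add_zero _))
  · exact List.sum_singleton
  · exact List.sum_nil

theorem sum_dWords_preCone_one_target
    (φ : ∀ b : Fin 2, A.Chain ((preCone f).obj b) Y → M) :
    ((List.finRange 2).map fun b => (((preCone f).dWords b (1 : Fin 2)).map (φ b)).sum).sum =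
      φ 0 (.cons f (.nil Y)) + φ 1 (.nil Y) := by
  obtain ⟨-, h₀, -, h₁⟩ := dWords_preCone f
  refine (sum_finRange_two _).trans (congrArg₂ (· + ·) ((congrArg (fun l => (l.map (φ 0)).sum) h₀).trans ?_)
    ((congrArg (fun l => (l.map (φ 1)).sum) h₁).trans ?_))
  · exact List.sum_singleton
  · exact List.sum_singleton

variable {f}

theorem sum_twWords_cone {d : ℤ} (z : A.twQuiver.Hom (cone f hf) (cone g hg) d) (i j : Fin 2)
    (F : A.Chain ((cone f hf).obj i) ((cone g hg).obj j) → M) :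
    ((twWords (.cons z (.nil (cone g hg))) i j).map F).sum =
      ((List.finRange 2).map fun a => (((preCone f).dWords i a).map fun w =>
        ((List.finRange 2).map fun b => (((preCone g).dWords b j).map fun v =>
          F (w.comp (.cons (z a b) v))).sum).sum).sum).sum := by
  simp only [twWords, sum_flatMap, List.map_map, Function.comp_def]
  rfl

/-- This is the only entry in which `f` and `g` occur; for a closed morphism it yields the equation
on the off-diagonal component. -/
theorem sum_twWords_cone_zero_one {d : ℤ} (z : A.twQuiver.Hom (cone f hf) (cone g hg) d)
    (hz : z (1 : Fin 2) (0 : Fin 2) = (0 : A.Hom Y X (d + 1 - 0))) (F : A.Chain X Y → M)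
    (hF : ∀ (Z Z' : Ob) (d : ℤ) (p : A.Chain X Z) (q : A.Chain Z' Y),
      F (p.comp (.cons (0 : A.Hom Z Z' d) q)) = 0) :
    ((twWords (.cons z (.nil (cone g hg))) (0 : Fin 2) (1 : Fin 2)).map F).sum =
      F (.cons (z (0 : Fin 2) (0 : Fin 2)) (.cons g (.nil Y))) +
      F (.cons (z (0 : Fin 2) (1 : Fin 2)) (.nil Y)) +
      F (.cons f (.cons (z (1 : Fin 2) (1 : Fin 2)) (.nil Y))) := by
  refine (sum_twWords_cone z (0 : Fin 2) (1 : Fin 2) F).trans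
    ((sum_dWords_preCone_zero_source f _).trans
      ((congrArg₂ (· + ·) (sum_dWords_preCone_one_target g _)
        (sum_dWords_preCone_one_target g _)).trans ?_))
  -- The remaining fourth word passes through `f`, the zero entry from `Y` to `sX`, and `g`.
  refine congrArg₂ (· + ·) rfl ((congrArg₂ (· + ·) ?_ rfl).trans (zero_add _))
  rw [hz]
  exact hF _ _ _ (.cons f (.nil Y)) (.cons g (.nil Y))

theorem sum_twWords_cone_zero_zero {d : ℤ} (z : A.twQuiver.Hom (cone f hf) (cone g hg) d)
    (hz : z (1 : Fin 2) (0 : Fin 2) = (0 : A.Hom Y X (d + 1 - 0))) (F : A.Chain X X → M)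
    (hF : ∀ (Z Z' : Ob) (d : ℤ) (p : A.Chain X Z) (q : A.Chain Z' X),
      F (p.comp (.cons (0 : A.Hom Z Z' d) q)) = 0) :
    ((twWords (.cons z (.nil (cone g hg))) (0 : Fin 2) (0 : Fin 2)).map F).sum =
      F (.cons (z (0 : Fin 2) (0 : Fin 2)) (.nil X)) := by
  refine (sum_twWords_cone z (0 : Fin 2) (0 : Fin 2) F).trans
    ((sum_dWords_preCone_zero_source f _).trans
      ((congrArg₂ (· + ·) (sum_dWords_preCone_zero_target g _)
        (sum_dWords_preCone_zero_target g _)).trans ?_))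
  refine (congrArg₂ (· + ·) rfl ?_).trans (add_zero _)
  rw [hz]
  exact hF _ _ _ (.cons f (.nil Y)) (.nil X)

theorem sum_twWords_cone_one_zero {d : ℤ} (z : A.twQuiver.Hom (cone f hf) (cone g hg) d)
    (hz : z (1 : Fin 2) (0 : Fin 2) = (0 : A.Hom Y X (d + 1 - 0))) (F : A.Chain Y X → M)
    (hF : ∀ (Z Z' : Ob) (d : ℤ) (p : A.Chain Y Z) (q : A.Chain Z' X),
      F (p.comp (.cons (0 : A.Hom Z Z' d) q)) = 0) :
    ((twWords (.cons z (.nil (cone g hg))) (1 : Fin 2) (0 : Fin 2)).map F).sum = 0 := by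
  refine (sum_twWords_cone z (1 : Fin 2) (0 : Fin 2) F).trans
    ((sum_dWords_preCone_one_source f _).trans ((sum_dWords_preCone_zero_target g _).trans ?_))
  rw [hz]
  exact hF _ _ _ (.nil Y) (.nil X)

theorem sum_twWords_cone_one_one {d : ℤ} (z : A.twQuiver.Hom (cone f hf) (cone g hg) d)
    (hz : z (1 : Fin 2) (0 : Fin 2) = (0 : A.Hom Y X (d + 1 - 0))) (F : A.Chain Y Y → M)
    (hF : ∀ (Z Z' : Ob) (d : ℤ) (p : A.Chain Y Z) (q : A.Chain Z' Y),
      F (p.comp (.cons (0 : A.Hom Z Z' d) q)) = 0) :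
    ((twWords (.cons z (.nil (cone g hg))) (1 : Fin 2) (1 : Fin 2)).map F).sum =
      F (.cons (z (1 : Fin 2) (1 : Fin 2)) (.nil Y)) := by
  refine (sum_twWords_cone z (1 : Fin 2) (1 : Fin 2) F).trans
    ((sum_dWords_preCone_one_source f _).trans ((sum_dWords_preCone_one_target g _).trans ?_))
  refine (congrArg₂ (· + ·) ?_ rfl).trans (zero_add _)
  rw [hz]
  exact hF _ _ _ (.nil Y) (.cons g (.nil Y))

/-- The components of a triangular morphism of cones that start in `i`, if those that increase the
index do not contribute. -/
theorem sum_twWords_cone_source {d : ℤ} (z : A.twQuiver.Hom (cone f hf) (cone g hg) d)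
    (hz : z (1 : Fin 2) (0 : Fin 2) = (0 : A.Hom Y X (d + 1 - 0))) (i : Fin 2)
    (φ : ∀ a : Fin 2, A.Chain ((cone f hf).obj i) ((cone g hg).obj a) → M)
    (hφ : ∀ (a : Fin 2) (Z Z' : Ob) (d : ℤ) (p : A.Chain ((cone f hf).obj i) Z)
      (q : A.Chain Z' ((cone g hg).obj a)), φ a (p.comp (.cons (0 : A.Hom Z Z' d) q)) = 0)
    (h : ∀ a w, i < a → φ a w = 0) :
    ((List.finRange 2).map fun a =>
      ((twWords (.cons z (.nil (cone g hg))) i a).map (φ a)).sum).sum =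
        φ i (.cons (z i i) (.nil _)) := by
  refine (sum_finRange_two _).trans ?_
  fin_cases i
  · refine (congrArg₂ (· + ·) (sum_twWords_cone_zero_zero z hz (φ 0) (hφ 0))
      (List.sum_eq_zero fun x hx => ?_)).trans (add_zero _)
    obtain ⟨w, -, rfl⟩ := List.mem_map.1 hx
    exact h 1 w (by decide)
  · exact (congrArg₂ (· + ·) (sum_twWords_cone_one_zero z hz (φ 0) (hφ 0))
      (sum_twWords_cone_one_one z hz (φ 1) (hφ 1))).trans (zero_add _)

/-- The components of a triangular morphism of cones that end in `j`, if those that increase the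
index do not contribute. -/
theorem sum_twWords_cone_target {d : ℤ} (z : A.twQuiver.Hom (cone f hf) (cone g hg) d)
    (hz : z (1 : Fin 2) (0 : Fin 2) = (0 : A.Hom Y X (d + 1 - 0))) (j : Fin 2)
    (φ : ∀ b : Fin 2, A.Chain ((cone f hf).obj b) ((cone g hg).obj j) → M)
    (hφ : ∀ (b : Fin 2) (Z Z' : Ob) (d : ℤ) (p : A.Chain ((cone f hf).obj b) Z)
      (q : A.Chain Z' ((cone g hg).obj j)), φ b (p.comp (.cons (0 : A.Hom Z Z' d) q)) = 0)
    (h : ∀ b v, b < j → φ b v = 0) :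
    ((List.finRange 2).map fun b =>
      ((twWords (.cons z (.nil (cone g hg))) b j).map (φ b)).sum).sum =
        φ j (.cons (z j j) (.nil _)) := by
  refine (sum_finRange_two _).trans ?_
  fin_cases j
  · exact (congrArg₂ (· + ·) (sum_twWords_cone_zero_zero z hz (φ 0) (hφ 0))
      (sum_twWords_cone_one_zero z hz (φ 1) (hφ 1))).trans (add_zero _)
  · refine (congrArg₂ (· + ·) (List.sum_eq_zero fun x hx => ?_)
      (sum_twWords_cone_one_one z hz (φ 1) (hφ 1))).trans (zero_add _)
    obtain ⟨w, -, rfl⟩ := List.mem_map.1 hx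
    exact h 0 w (by decide)

end sums

end AInftyCategory

/-! ### Triangularity of the differential and of multiplication in `Tw A`. -/

namespace AInftyCategory

open GradedQuiver (sgn_of)

variable {k : Type w} [CommRing k] {Ob : Type u} {A : AInftyCategory.{u, v} k Ob}

theorem bTot_neg {W X Y Z : Ob} (p : A.Chain W X) {d : ℤ} (x : A.Hom X Y d) (q : A.Chain Y Z) :
    A.bTot (p.comp (.cons (-x) q)) = - A.bTot (p.comp (.cons x q)) := by
  have := bTot_smul A.toAInftyData p (-1 : k) x q
  rwa [neg_one_smul, neg_one_smul] at this

theorem mulLeft_neg (W : Ob) {X Y : Ob} (a : A.Hom X Y 0) (x : A.Tot W X) :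
    mulLeft W (-a) x = - mulLeft W a x :=
  tot_ext (G := - mulLeft W a) (fun d x => by
    rw [LinearMap.neg_apply, mulLeft_of_eq_bTot, mulLeft_of_eq_bTot]
    exact bTot_neg (.cons x (.nil X)) a (.nil Y)) x

theorem mulRight_neg (W : Ob) {X Y : Ob} (a : A.Hom X Y 0) (x : A.Tot Y W) :
    mulRight W (-a) x = - mulRight W a x :=
  tot_ext (G := - mulRight W a) (fun d x => by
    rw [LinearMap.neg_apply, mulRight_of_eq_bTot, mulRight_of_eq_bTot, ← smul_neg]
    exact congrArg _ (bTot_neg (.nil X) a (.cons x (.nil W)))) x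

/-- The diagonal of a differential in `Tw A` is `m¹` only up to sign; multiplying the homotopy by
the same sign compensates. -/
theorem htpic_units_smul {M : Type*} [AddCommGroup M] [Module k M] (ε : ℤˣ) {D F : M →ₗ[k] M}
    (h : Htpic D D F .id) : Htpic (ε • D) (ε • D) F .id := by
  obtain ⟨H, hH⟩ := h
  refine ⟨ε • H, fun x => ?_⟩
  simp only [LinearMap.smul_apply, map_unit_smul, smul_smul, Int.units_mul_self, one_smul, hH]

/-- The order on matrix entries for which multiplication with triangular matrices is triangular. -/
def entryRank (r s : ℕ) (p : Fin r × Fin s) : ℕ := p.2 + (r - p.1)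

/-- The entry `(i, j)` of the differential involves the entries `(a, b)` with `i ≤ a` and `b ≤ j`.
All of these have smaller rank, except `(i, j)` itself, where no `δ` is inserted. -/
theorem hasDiag_diff (T S : A.TwistedComplex) :
    HasDiag (entryRank T.r S.r) (entryEquiv T S) (entryEquiv T S) (A.Tw.diff T S)
      fun p => (S.shift p.2).negOnePow • A.diff (T.obj p.1) (S.obj p.2) := by
  rintro z ⟨i, j⟩ hz
  replace hz (a : Fin T.r) (b : Fin S.r) (hab : (b : ℕ) + (T.r - a) < j + (T.r - i)) :
    entry a b z = 0 := hz (a, b) hab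
  refine (entry_slot_apply i j (.nil T) (.nil S) z).trans ?_
  rw [LinearMap.smul_apply]
  refine congrArg _ ?_
  -- For `a ≥ i` every `b < j` gives an entry of smaller rank than `(i, j)`, so only `b = j`
  -- remains; then `a > i` is excluded in the same way.
  have inner (a : Fin T.r) (ha : i ≤ a) (w : A.Chain (T.obj i) (T.obj a)) :
      ((List.finRange S.r).map fun b => ((twWords (.nil S) b j).map fun v =>
        slot A.toAInftyData w v (entry a b z)).sum).sum =
      slot A.toAInftyData w (.nil _) (entry a j z) :=
    sum_dWords_target S.toPreTwisted j (fun b v => slot A.toAInftyData w v (entry a b z))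
      fun b v hb => by rw [hz a b (by omega), map_zero]
  refine (sum_dWords_source T.toPreTwisted i (fun a w =>
      ((List.finRange S.r).map fun b => ((twWords (.nil S) b j).map fun v =>
        slot A.toAInftyData w v (entry a b z)).sum).sum) fun a w ha => ?_).trans
    (inner i le_rfl _)
  rw [inner a ha.le, hz a j (by omega), map_zero]

theorem entry_sgn_eq_zero {T S : A.TwistedComplex} {i : Fin T.r} {j : Fin S.r}
    {z : A.twQuiver.Tot T S} (h : entry i j z = 0) : entry i j (A.twQuiver.sgn T S z) = 0 := by
  rw [entry_sgn, h, map_zero, smul_zero]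

/-- Right multiplication carries the sign of the target shift from the operations of `Tw A` and a
sign from `sgn`. Together they leave the sign of the source shift, independent of the target. -/
theorem smul_entry_sgn {T S : A.TwistedComplex} (i : Fin T.r) (j : Fin S.r) {N : Type*}
    [AddCommGroup N] [Module k N] (φ : A.Tot (T.obj i) (S.obj j) →ₗ[k] N)
    (z : A.twQuiver.Tot T S) :
    (S.shift j).negOnePow • φ (entry i j (A.twQuiver.sgn T S z)) =
      (T.shift i).negOnePow • φ (A.sgn (T.obj i) (S.obj j) (entry i j z)) := by
  rw [entry_sgn, map_unit_smul, smul_smul, ← Int.negOnePow_add]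
  refine congrArg (· • _) (negOnePow_congr (S.shift j - T.shift i) ?_)
  ring

section cone

variable {X Y : Ob} {f g : A.Hom X Y 0} {hf : A.IsClosed f} {hg : A.IsClosed g}

/-- The decomposition of morphisms to a cone. -/
noncomputable def entryEquivTarget (W : A.TwistedComplex) (f : A.Hom X Y 0) (hf : A.IsClosed f) :
    A.Tw.Tot W (cone f hf) ≃ₗ[k]
      ∀ p : Fin W.r × Fin 2, A.Tot (W.obj p.1) ((![X, Y] : Fin 2 → Ob) p.2) :=
  entryEquiv W (cone f hf)

/-- The decomposition of morphisms from a cone. -/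
noncomputable def entryEquivSource (W : A.TwistedComplex) (f : A.Hom X Y 0) (hf : A.IsClosed f) :
    A.Tw.Tot (cone f hf) W ≃ₗ[k]
      ∀ p : Fin 2 × Fin W.r, A.Tot ((![X, Y] : Fin 2 → Ob) p.1) (W.obj p.2) :=
  entryEquiv (cone f hf) W

/-- The zero entry of `z` makes it triangular, like `δ`, so the rank argument for the differential
applies again. Both cones have the objects `![X, Y]`, so one family of modules serves as entries of
source and target although `f` and `g` differ. -/
theorem hasDiag_mulLeft (W : A.TwistedComplex) (z : A.Tw.Hom (cone f hf) (cone g hg) 0)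
    (hz : z (1 : Fin 2) (0 : Fin 2) = (0 : A.Hom Y X (0 + 1 - 0))) :
    HasDiag (Q := fun p : Fin W.r × Fin 2 => A.Tot (W.obj p.1) ((![X, Y] : Fin 2 → Ob) p.2))
      (entryRank W.r 2) (entryEquivTarget W f hf) (entryEquivTarget W g hg)
      (mulLeft W z) fun p => ((![1, 0] : Fin 2 → ℤ) p.2).negOnePow •
        slot A.toAInftyData (.nil (W.obj p.1)) (.cons (z p.2 p.2) (.nil _)) := by
  rintro x ⟨i, j⟩ hx
  replace hx (a : Fin W.r) (b : Fin 2) (hab : (b : ℕ) + (W.r - a) < j + (W.r - i)) :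
    entry a b x = 0 := hx (a, b) hab
  refine (entry_slot_apply i j (.nil W) (.cons z (.nil (cone g hg))) x).trans ?_
  refine congrArg (((![1, 0] : Fin 2 → ℤ) j).negOnePow • ·) ?_
  have inner (a : Fin W.r) (ha : i ≤ a) (w : A.Chain (W.obj i) (W.obj a)) :
      ((List.finRange 2).map fun b => ((twWords (.cons z (.nil (cone g hg))) b j).map fun v =>
        slot A.toAInftyData w v (entry a b x)).sum).sum =
      slot A.toAInftyData w (.cons (z j j) (.nil _)) (entry a j x) :=
    sum_twWords_cone_target z hz j (fun b v => slot A.toAInftyData w v (entry a b x))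
      (fun b Z Z' d p q => slot_right_zero w p d q _)
      fun b v hb => by rw [hx a b (by omega), map_zero]
  refine (sum_dWords_source W.toPreTwisted i (fun a w =>
      ((List.finRange 2).map fun b => ((twWords (.cons z (.nil (cone g hg))) b j).map fun v =>
        slot A.toAInftyData w v (entry a b x)).sum).sum) fun a w ha => ?_).trans
    (inner i le_rfl _)
  rw [inner a ha.le, hx a j (by omega), map_zero]

/-- The part of right multiplication before `sgn` is inserted, with the vanishing hypothesis on `x`
itself so that it can be used for `sgn` of an element. -/
theorem entry_slot_cone (W : A.TwistedComplex) (z : A.twQuiver.Hom (cone f hf) (cone g hg) 0)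
    (hz : z (1 : Fin 2) (0 : Fin 2) = (0 : A.Hom Y X (0 + 1 - 0)))
    (x : A.twQuiver.Tot (cone g hg) W) (i : Fin 2) (j : Fin W.r)
    (hx : ∀ (a : Fin 2) (b : Fin W.r), (b : ℕ) + (2 - a) < j + (2 - i) → entry a b x = 0) :
    entry (T := cone f hf) i j (slot A.twData (.cons z (.nil (cone g hg))) (.nil W) x) =
      (W.shift j).negOnePow • slot A.toAInftyData (.cons (z i i) (.nil _)) (.nil (W.obj j))
        (entry i j x) := by
  refine (entry_slot_apply (T := cone f hf) i j (.cons z (.nil (cone g hg))) (.nil W) x).trans ?_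
  refine congrArg ((W.shift j).negOnePow • ·) ?_
  have inner (a : Fin 2) (ha : i ≤ a) (w : A.Chain ((cone f hf).obj i) ((cone g hg).obj a)) :
      ((List.finRange W.r).map fun b => ((twWords (.nil W) b j).map fun v =>
        slot A.toAInftyData w v (entry a b x)).sum).sum =
      slot A.toAInftyData w (.nil _) (entry a j x) :=
    sum_dWords_target W.toPreTwisted j (fun b v => slot A.toAInftyData w v (entry a b x))
      fun b v hb => by rw [hx a b (by omega), map_zero]
  have h₁ (a : Fin 2) (Z Z' : Ob) (d : ℤ) (p : A.Chain ((cone f hf).obj i) Z)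
      (q : A.Chain Z' ((cone g hg).obj a)) :
    ((List.finRange W.r).map fun b => ((twWords (.nil W) b j).map fun v =>
        slot A.toAInftyData (p.comp (.cons (0 : A.Hom Z Z' d) q)) v (entry a b x)).sum).sum = 0 := by
    simp only [slot_left_zero, List.map_const', List.sum_replicate, smul_zero]
  have h₂ (a : Fin 2) (w : A.Chain ((cone f hf).obj i) ((cone g hg).obj a)) (ha : i < a) :
    ((List.finRange W.r).map fun b => ((twWords (.nil W) b j).map fun v =>
        slot A.toAInftyData w v (entry a b x)).sum).sum = 0 := by
    rw [inner a ha.le, hx a j (by omega), map_zero]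
  have := sum_twWords_cone_source z hz i (fun a w =>
      ((List.finRange W.r).map fun b => ((twWords (.nil W) b j).map fun v =>
        slot A.toAInftyData w v (entry a b x)).sum).sum) h₁ h₂
  exact this.trans (inner i le_rfl _)
theorem hasDiag_mulRight (W : A.TwistedComplex) (z : A.Tw.Hom (cone f hf) (cone g hg) 0)
    (hz : z (1 : Fin 2) (0 : Fin 2) = (0 : A.Hom Y X (0 + 1 - 0))) :
    HasDiag (Q := fun p : Fin 2 × Fin W.r => A.Tot ((![X, Y] : Fin 2 → Ob) p.1) (W.obj p.2))
      (entryRank 2 W.r) (entryEquivSource W g hg) (entryEquivSource W f hf)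
      (mulRight W z) fun p => ((![1, 0] : Fin 2 → ℤ) p.1).negOnePow •
        (slot A.toAInftyData (.cons (z p.1 p.1) (.nil _)) (.nil (W.obj p.2)) ∘ₗ A.sgn _ _) := by
  rintro x ⟨i, j⟩ hx
  refine (entry_slot_cone W z hz (A.twQuiver.sgn (cone g hg) W x) i j fun a b hab =>
    entry_sgn_eq_zero (T := cone g hg) (hx (a, b) hab)).trans ?_
  exact smul_entry_sgn (T := cone g hg) i j
    (slot A.toAInftyData (.cons (z i i) (.nil _)) (.nil (W.obj j))) x

/-- Closedness is checked entry by entry: the diagonal requires `a₀` and `a₁` to be closed, the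
entry from `Y` to `sX` is empty, and the entry from `sX` to `Y` is the equation `h`. -/
theorem isClosed_cone (z : A.Tw.Hom (cone f hf) (cone g hg) 0)
    (hz : z (1 : Fin 2) (0 : Fin 2) = (0 : A.Hom Y X (0 + 1 - 0)))
    {a₀ : A.Hom X X 0} {a₁ : A.Hom Y Y 0} (h₀ : z (0 : Fin 2) (0 : Fin 2) = a₀)
    (h₁ : z (1 : Fin 2) (1 : Fin 2) = a₁) (ha₀ : A.IsClosed a₀) (ha₁ : A.IsClosed a₁)
    {u : A.Hom X Y (0 + 0 - 1)} (hu : z (0 : Fin 2) (1 : Fin 2) = u)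
    (h : A.m₂ g a₀ 0 rfl + A.m₁ u 0 rfl + A.m₂ a₁ f 0 rfl = 0) : A.Tw.IsClosed z := by
  rw [isClosed_iff, ← bTot_one]
  refine (entryEquiv (cone f hf) (cone g hg)).injective (Eq.trans ?_ (map_zero _).symm)
  have key (i j : Fin 2) :
      twSum (A := A) (.cons (Y := cone g hg) z (.nil (cone g hg))) i j = 0 := by
    fin_cases i <;> fin_cases j
    · refine (sum_twWords_cone_zero_zero z hz A.bTot fun Z Z' d p q => bTot_comp_zero p d q).trans ?_
      rw [h₀]
      exact bTot_one_of_isClosed ha₀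
    · refine (sum_twWords_cone_zero_one z hz A.bTot fun Z Z' d p q => bTot_comp_zero p d q).trans ?_
      rw [h₀, h₁, hu]
      have e₁ : A.bTot (.cons a₀ (.cons g (.nil Y))) = DirectSum.of (A.Hom X Y) 0 (A.m₂ g a₀ 0 rfl) := by
        rw [← mulLeft_of_eq_bTot, mulLeft_of]
      have e₂ : A.bTot (.cons f (.cons a₁ (.nil Y))) = DirectSum.of (A.Hom X Y) 0 (A.m₂ a₁ f 0 rfl) := by
        rw [← mulLeft_of_eq_bTot, mulLeft_of]
      refine (congrArg₂ (· + ·) (congrArg₂ (· + ·) e₁ ((bTot_one u).trans (diff_of u 0 rfl))) e₂).trans ?_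
      simp only [← map_add, h, map_zero]
      rfl
    · exact sum_twWords_cone_one_zero z hz A.bTot fun Z Z' d p q => bTot_comp_zero p d q
    · refine (sum_twWords_cone_one_one z hz A.bTot fun Z Z' d p q => bTot_comp_zero p d q).trans ?_
      rw [h₁]
      exact bTot_one_of_isClosed ha₁
  funext p
  refine (entry_bTot p.1 p.2 _).trans ?_
  exact (congrArg _ (key p.1 p.2)).trans (smul_zero _)

/-- The degrees of the entries, shifted by `![1, 0]`, reduce by computation, so morphisms of `A` can
be used directly as entries. -/
theorem exists_morphism_cone (a₀ : A.Hom X X 0) (a₁ : A.Hom Y Y 0) (u : A.Hom X Y (0 + 0 - 1)) :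
    ∃ z : A.Tw.Hom (cone f hf) (cone g hg) 0,
      z (1 : Fin 2) (0 : Fin 2) = (0 : A.Hom Y X (0 + 1 - 0)) ∧ z (0 : Fin 2) (0 : Fin 2) = a₀ ∧
      z (1 : Fin 2) (1 : Fin 2) = a₁ ∧ z (0 : Fin 2) (1 : Fin 2) = u :=
  ⟨fun (i j : Fin 2) => match i, j with
    | 0, 0 => a₀
    | 0, 1 => u
    | 1, 0 => (0 : A.Hom Y X (0 + 1 - 0))
    | 1, 1 => a₁, rfl, rfl, rfl, rfl⟩

end cone

end AInftyCategory

/-! ### The isomorphism between the cones. -/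

namespace AInftyCategory

section cone

variable {k : Type w} [CommRing k] {Ob : Type u} {A : AInftyCategory.{u, v} k Ob}
variable {X Y : Ob} {f g : A.Hom X Y 0} {hf : A.IsClosed f} {hg : A.IsClosed g}

theorem IsUnit.htpic_mulLeft {X : Ob} {e : A.Hom X X 0} (he : A.IsUnit e) (W : Ob) :
    Htpic (A.diff W X) (A.diff W X) (mulLeft W e) .id :=
  htpic_of_homotopicToId (he.2.1 W) _ fun _ x => mulLeft_of W e x

theorem IsUnit.htpic_mulRight {X : Ob} {e : A.Hom X X 0} (he : A.IsUnit e) (W : Ob) :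
    Htpic (A.diff X W) (A.diff X W) (mulRight W e) .id :=
  htpic_of_homotopicToId (he.2.2 W) _ fun _ x => mulRight_of W e x

/-- The diagonal does not see `f`, so the differentials for `cone f` and `cone g` share it, as
`HtpyEquiv.of_hasDiag` requires. -/
theorem hasDiag_diff_target (W : A.TwistedComplex) (f : A.Hom X Y 0) (hf : A.IsClosed f) :
    HasDiag (Q := fun p : Fin W.r × Fin 2 => A.Tot (W.obj p.1) ((![X, Y] : Fin 2 → Ob) p.2))
      (entryRank W.r 2) (entryEquivTarget W f hf) (entryEquivTarget W f hf)
      (A.Tw.diff W (cone f hf)) fun p => ((![1, 0] : Fin 2 → ℤ) p.2).negOnePow •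
        A.diff (W.obj p.1) ((![X, Y] : Fin 2 → Ob) p.2) :=
  hasDiag_diff W (cone f hf)

theorem hasDiag_diff_source (W : A.TwistedComplex) (f : A.Hom X Y 0) (hf : A.IsClosed f) :
    HasDiag (Q := fun p : Fin 2 × Fin W.r => A.Tot ((![X, Y] : Fin 2 → Ob) p.1) (W.obj p.2))
      (entryRank 2 W.r) (entryEquivSource W f hf) (entryEquivSource W f hf)
      (A.Tw.diff (cone f hf) W) fun p => (W.shift p.2).negOnePow •
        A.diff ((![X, Y] : Fin 2 → Ob) p.1) (W.obj p.2) :=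
  hasDiag_diff (cone f hf) W

theorem htpyEquiv_mulLeft (W : A.TwistedComplex) {z : A.Tw.Hom (cone f hf) (cone g hg) 0}
    (hz : A.Tw.IsClosed z) (hz₀ : z (1 : Fin 2) (0 : Fin 2) = (0 : A.Hom Y X (0 + 1 - 0)))
    {e : A.Hom X X 0} {e' : A.Hom Y Y 0} (h₀ : z (0 : Fin 2) (0 : Fin 2) = -e)
    (h₁ : z (1 : Fin 2) (1 : Fin 2) = e') (he : A.IsUnit e) (he' : A.IsUnit e') :
    HtpyEquiv (A.Tw.diff W (cone f hf)) (A.Tw.diff W (cone g hg)) (mulLeft W z) := by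
  refine HtpyEquiv.of_hasDiag diff_diff diff_diff (diff_mulLeft W hz)
    (hasDiag_diff_target W f hf) (hasDiag_diff_target W g hg) (hasDiag_mulLeft W z hz₀) ?_
  rintro ⟨i, j⟩
  refine htpic_units_smul _ ?_
  fin_cases j
  · obtain ⟨H, hH⟩ := he.htpic_mulLeft (W.obj i)
    refine ⟨H, fun x => (congrArg (· - x) ?_).trans (hH x)⟩
    change (1 : ℤ).negOnePow • slot A.toAInftyData (.nil (W.obj i))
      (.cons (z (0 : Fin 2) (0 : Fin 2)) (.nil X)) x = _
    -- The sign from the shift of `X` cancels the one in `-e`, leaving multiplication by `e`.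
    rw [h₀, Int.negOnePow_one, Units.neg_smul, one_smul]
    refine (congrArg _ (mulLeft_neg (W.obj i) e x)).trans (neg_neg _)
  · obtain ⟨H, hH⟩ := he'.htpic_mulLeft (W.obj i)
    refine ⟨H, fun x => (congrArg (· - x) ?_).trans (hH x)⟩
    change (0 : ℤ).negOnePow • slot A.toAInftyData (.nil (W.obj i))
      (.cons (z (1 : Fin 2) (1 : Fin 2)) (.nil Y)) x = _
    rw [h₁, Int.negOnePow_zero, one_smul]
    rfl

theorem htpyEquiv_mulRight (W : A.TwistedComplex) {z : A.Tw.Hom (cone f hf) (cone g hg) 0}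
    (hz : A.Tw.IsClosed z) (hz₀ : z (1 : Fin 2) (0 : Fin 2) = (0 : A.Hom Y X (0 + 1 - 0)))
    {e : A.Hom X X 0} {e' : A.Hom Y Y 0} (h₀ : z (0 : Fin 2) (0 : Fin 2) = -e)
    (h₁ : z (1 : Fin 2) (1 : Fin 2) = e') (he : A.IsUnit e) (he' : A.IsUnit e') :
    HtpyEquiv (A.Tw.diff (cone g hg) W) (A.Tw.diff (cone f hf) W) (mulRight W z) := by
  refine HtpyEquiv.of_hasDiag diff_diff diff_diff (diff_mulRight W hz)
    (hasDiag_diff_source W g hg) (hasDiag_diff_source W f hf) (hasDiag_mulRight W z hz₀) ?_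
  rintro ⟨i, j⟩
  refine htpic_units_smul _ ?_
  fin_cases i
  · obtain ⟨H, hH⟩ := he.htpic_mulRight (W.obj j)
    refine ⟨H, fun x => (congrArg (· - x) ?_).trans (hH x)⟩
    change (1 : ℤ).negOnePow • slot A.toAInftyData
      (.cons (z (0 : Fin 2) (0 : Fin 2)) (.nil X)) (.nil (W.obj j)) (A.sgn X (W.obj j) x) = _
    -- The same cancellation on the right, where the sign comes from the shift of the source.
    rw [h₀, Int.negOnePow_one, Units.neg_smul, one_smul]
    refine (congrArg _ (mulRight_neg (W.obj j) e x)).trans (neg_neg _)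
  · obtain ⟨H, hH⟩ := he'.htpic_mulRight (W.obj j)
    refine ⟨H, fun x => (congrArg (· - x) ?_).trans (hH x)⟩
    change (0 : ℤ).negOnePow • slot A.toAInftyData
      (.cons (z (1 : Fin 2) (1 : Fin 2)) (.nil Y)) (.nil (W.obj j)) (A.sgn Y (W.obj j) x) = _
    rw [h₁, Int.negOnePow_zero, one_smul]
    rfl

/-- The condition on the off-diagonal entry of a closed morphism between cones is solvable. -/
theorem exists_off_diagonal {e : A.Hom X X 0} {e' : A.Hom Y Y 0} (he : A.IsUnit e)
    (he' : A.IsUnit e') (hf : A.IsClosed f) (hg : A.IsClosed g) (hfg : A.Cohomologous f g) :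
    ∃ u : A.Hom X Y (0 + 0 - 1), A.m₂ g (-e) 0 rfl + A.m₁ u 0 rfl + A.m₂ e' f 0 rfl = 0 := by
  obtain ⟨H, hH⟩ := he.htpic_mulRight Y
  obtain ⟨H', hH'⟩ := he'.htpic_mulLeft X
  obtain ⟨t, ht⟩ := (cohomologous_iff f g).1 hfg
  have h₁ := hH (DirectSum.of _ 0 g)
  have h₂ := hH' (DirectSum.of _ 0 f)
  rw [(isClosed_iff g).1 hg, map_zero, add_zero, LinearMap.id_apply] at h₁
  rw [(isClosed_iff f).1 hf, map_zero, add_zero, LinearMap.id_apply] at h₂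
  -- As `f` and `g` are closed, the homotopies give `m²(g, e) - g = D (H g)` and `m²(e', f) - f = D
  -- (H' f)`; with `f - g = D t` one gets `D s = m²(g, e) - m²(e', f)`. The entry `u` is the part of
  -- `s` of degree `-1`, written `0 + 0 - 1` to match the matrix entry.
  let s := H (DirectSum.of _ 0 g) - H' (DirectSum.of _ 0 f) - t
  refine ⟨s (0 + 0 - 1), DirectSum.of_injective (β := A.Hom X Y) 0 ?_⟩
  have hs : A.diff X Y s =
      mulRight Y e (DirectSum.of _ 0 g) - mulLeft X e' (DirectSum.of _ 0 f) := by
    rw [map_sub, map_sub, ← h₁, ← h₂, ← ht]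
    abel
  have h₀ : DirectSum.of (A.Hom X Y) 0 (A.m₁ (s (0 + 0 - 1)) 0 rfl) =
      mulRight Y e (DirectSum.of _ 0 g) - mulLeft X e' (DirectSum.of _ 0 f) := by
    rw [← diff_apply, hs, mulRight_of, mulLeft_of, ← map_sub, DirectSum.of_eq_same]
  rw [map_add, map_add, h₀, ← mulRight_of Y (-e) g, ← mulLeft_of X e' f, mulRight_neg, map_zero]
  abel

end cone

end AInftyCategory

/-- In a unital `A_∞`-category over a commutative ring, cohomologous closed morphisms of degree `0`
have mapping cones that are isomorphic in `H⁰` of the `A_∞`-category of twisted complexes. -/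
theorem mainTheorem11 {k : Type w} [CommRing k] {Ob : Type u} (A : AInftyCategory.{u, v, w} k Ob)
    (hA : A.IsUnital) {X Y : Ob} (f g : A.Hom X Y 0) (hf : A.IsClosed f) (hg : A.IsClosed g)
    (hfg : A.Cohomologous f g) :
    A.Tw.IsomorphicInH0 (AInftyCategory.cone f hf) (AInftyCategory.cone g hg) := by
  obtain ⟨e, he⟩ := hA X
  obtain ⟨e', he'⟩ := hA Y
  obtain ⟨u, hu⟩ := AInftyCategory.exists_off_diagonal he he' hf hg hfg
  obtain ⟨z, h₁₀, h₀₀, h₁₁, h₀₁⟩ :=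
    AInftyCategory.exists_morphism_cone (hf := hf) (hg := hg) (-e) e' u
  have hne : A.IsClosed (-e) := by
    rw [AInftyCategory.isClosed_iff, map_neg, map_neg, (AInftyCategory.isClosed_iff e).1 he.1,
      neg_zero]
  have hz := AInftyCategory.isClosed_cone z h₁₀ h₀₀ h₁₁ hne he'.1 h₀₁ hu
  exact AInftyCategory.isomorphicInH0_of_htpyEquiv hz
    (fun W => AInftyCategory.htpyEquiv_mulLeft W hz h₁₀ h₀₀ h₁₁ he he')
    (fun W => AInftyCategory.htpyEquiv_mulRight W hz h₁₀ h₀₀ h₁₁ he he')
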